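/- Let $n\ge 1$. A \emph{Riesz MV-algebra} is a structure $(R,\oplus,{}^*,0,\{r\}_{r\in[0,1]})$ such that $(R,\oplus,0)$ is an Abelian monoid, $x^{**}=x$, $(x^*\oplus y)^*\oplus y=(y^*\oplus x)^*\oplus x$, $0^*\oplus x=0^*$, and, with $x\odot y=(x^*\oplus y^*)^*$, $r(x\odot y^*)=(rx)\odot(ry)^*$, $(r\odot q^*)x=(rx)\odot(qx)^*$, $r(qx)=(rq)x$, $1x=x$ for $x,y\in R$, $r,q\in[0,1]$. Here $[0,1]$ carries $x\oplus y=\min(1,x+y)$ and $x^*=1-x$; with $rx$ the real product it is itself a Riesz MV-algebra. With $1=0^*$ in $R$, a \emph{state} is a map $s:R\to[0,1]$ with $s(1)=1$ and $s(x\oplus y)=s(x)+s(y)$ whenever $x\odot y=0$; it is \emph{faithful} if $s(x)=0$ implies $x=0$. Put $\rho_s(x,y)=s((x\odot y^*)\oplus(x^*\odot y))$; $(R,s)$ is \emph{state-complete} if $(R,\rho_s)$ is a complete metric space. A \emph{norm-completion} of $(R,s)$, $s$ a faithful state, is a state-complete Riesz MV-algebra $(S,t)$ with $t$ a faithful state,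 together with an injective Riesz MV-algebra homomorphism $\iota:R\to S$ such that $t\circ\iota=s$ and $\iota(R)$ is $\rho_t$-dense in $S$. Let $RL_n$ be the Lindenbaum--Tarski algebra (formulas modulo provable equivalence) of the logic whose formulas are built from $n$ variables with the connectives $\neg,\to,\nabla_r$ ($r\in[0,1]$), whose only rule is modus ponens, and whose axioms are $\varphi\to(\psi\to\varphi)$, $(\varphi\to\psi)\to((\psi\to\chi)\to(\varphi\to\chi))$, $((\varphi\to\psi)\to\psi)\to((\psi\to\varphi)\to\varphi)$, $(\neg\psi\to\neg\varphi)\to(\varphi\to\psi)$, $\nabla_r(\varphi\to\psi)\leftrightarrow(\nabla_r\varphi\to\nabla_r\psi)$, $\nabla_{r\odot q^*}\varphi\leftrightarrow(\nabla_q\varphi\to\nabla_r\varphi)$, $\nabla_r\nabla_q\varphi\leftrightarrow\nabla_{rq}\varphi$, $\nabla_1\varphi\leftrightarrow\varphi$, where $\alpha\leftrightarrow\beta$ is $\neg((\alpha\to\beta)\to\neg(\beta\to\alpha))$. Its operations are $[\varphi]\oplus[\psi]=[\neg\varphi\to\psi]$, $[\varphi]^*=[\neg\varphi]$, $0=[\neg(v\to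 v)]$ for a variable $v$, and $r[\varphi]=[\neg\nabla_r\neg\varphi]$. Let $f_\varphi:[0,1]^n\to[0,1]$ be the term function of $\varphi$, where $\neg$, $\to$, $\nabla_r$ are interpreted by $1-x$, $\min(1,1-x+y)$, $1-r(1-x)$, and let $I([\varphi])=\int_{[0,1]^n} f_\varphi(\mathbf x)\,d\mathbf x$. Let $\mu$ be Lebesgue measure on $[0,1]^n$ and let $L^1(\mu)_u$ be the set of $[0,1]$-valued $\mu$-integrable functions on $[0,1]^n$ modulo $\mu$-a.e. equality, with the pointwise operations $f\oplus g=\min(1,f+g)$, $f^*=1-f$, $0$, $rf$, and with $s_\mu(f)=\int f\,d\mu$. Then $L^1(\mu)_u$ is a Riesz MV-algebra, $s_\mu$ is a faithful state on it, and $(L^1(\mu)_u,s_\mu)$ is state-complete. Moreover $(L^1(\mu)_u,s_\mu)$ is, up to isomorphism, the norm-completion of $(RL_n,I)$: the algebra $RL_n$ is a Riesz MV-algebra with faithful state $I$; there is a map $\iota:RL_n\to L^1(\mu)_u$ sending each $[\varphi]$ to the class of $f_\varphi$, which makes $(L^1(\mu)_u,s_\mu)$ a norm-completion of $(RL_n,I)$;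 and for every norm-completion $(S,t)$, $j:RL_n\to S$, of $(RL_n,I)$ there is an isomorphism of Riesz MV-algebras $e:L^1(\mu)_u\to S$ with $t\circ e=s_\mu$ and $e\circ\iota=j$. -/

import Mathlib

open MeasureTheory unitInterval

namespace RMV

/-- The signature of Riesz MV-algebras: `⊕`, `*`, `0` and a unary operation for every
`r ∈ [0,1]`.  The laws are in `IsRieszMVAlgebra`. -/
class RieszMVOps (A : Type*) where
  oplus : A → A → A
  neg : A → A
  zero : A
  scal : I → A → A

section Derived

variable {A : Type*} [RieszMVOps A]

/-- `x ⊕ y`. -/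
def oplus (x y : A) : A := RieszMVOps.oplus x y

/-- `x*`. -/
def neg (x : A) : A := RieszMVOps.neg x

/-- `0`. -/
def zero : A := RieszMVOps.zero

/-- `r x`. -/
def scal (r : I) (x : A) : A := RieszMVOps.scal r x

/-- `1 = 0*`. -/
def one : A := neg zero

/-- `x ⊙ y = (x* ⊕ y*)*`. -/
def odot (x y : A) : A := neg (oplus (neg x) (neg y))

/-- `x → y = x* ⊕ y`. -/
def impl (x y : A) : A := oplus (neg x) y

end Derived

/-- The standard Riesz MV-algebra `[0,1]`: `x ⊕ y = min(1, x + y)`, `x* = 1 - x`, and `r x` is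
the product of reals. -/
noncomputable instance : RieszMVOps I where
  oplus x y := ⟨min 1 ((x : ℝ) + y), le_min zero_le_one (add_nonneg x.2.1 y.2.1), min_le_left _ _⟩
  neg x := ⟨1 - (x : ℝ), sub_nonneg.2 x.2.2, sub_le_self _ x.2.1⟩
  zero := 0
  scal r x := r * x

/-- The laws of Riesz MV-algebras.  In `scal_odot_scalar` the operations on the scalars
`r, q ∈ [0,1]` are those of the standard algebra `[0,1]`. -/
structure IsRieszMVAlgebra (A : Type*) [RieszMVOps A] : Prop where
  oplus_assoc : ∀ x y z : A, oplus (oplus x y) z = oplus x (oplus y z)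
  oplus_comm : ∀ x y : A, oplus x y = oplus y x
  oplus_zero : ∀ x : A, oplus x zero = x
  neg_neg : ∀ x : A, neg (neg x) = x
  lukasiewicz : ∀ x y : A, oplus (neg (oplus (neg x) y)) y = oplus (neg (oplus (neg y) x)) x
  neg_zero_oplus : ∀ x : A, oplus (neg zero) x = neg zero
  scal_odot : ∀ (r : I) (x y : A), scal r (odot x (neg y)) = odot (scal r x) (neg (scal r y))
  scal_odot_scalar : ∀ (r q : I) (x : A),
    scal (odot r (neg q)) x = odot (scal r x) (neg (scal q x))
  scal_scal : ∀ (r q : I) (x : A), scal r (scal q x) = scal (r * q) x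
  one_scal : ∀ x : A, scal 1 x = x

/-- Homomorphisms of Riesz MV-algebras. -/
structure IsRieszMVHom {A B : Type*} [RieszMVOps A] [RieszMVOps B] (f : A → B) : Prop where
  map_oplus : ∀ x y, f (oplus x y) = oplus (f x) (f y)
  map_neg : ∀ x, f (neg x) = neg (f x)
  map_zero : f zero = zero
  map_scal : ∀ r x, f (scal r x) = scal r (f x)

/-! ### States -/

section States

variable {A : Type*} [RieszMVOps A]

/-- A state `s : A → [0,1]` (written as a real-valued function with values in `[0,1]`). -/
structure IsState (s : A → ℝ) : Prop where
  mem_Icc : ∀ x, s x ∈ Set.Icc (0 : ℝ) 1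
  map_one : s one = 1
  map_oplus : ∀ x y, odot x y = zero → s (oplus x y) = s x + s y

/-- A Riesz MV-algebra normed by a faithful state. -/
structure IsNormed (s : A → ℝ) : Prop where
  isRieszMVAlgebra : IsRieszMVAlgebra A
  isState : IsState s
  faithful : ∀ x, s x = 0 → x = zero

/-- `ρ_s(x, y) = s((x ⊙ y*) ⊕ (x* ⊙ y))`. -/
def rho (s : A → ℝ) (x y : A) : ℝ := s (oplus (odot x (neg y)) (odot (neg x) y))

/-- `(A, ρ_s)` is a complete metric space. -/
def IsStateComplete (s : A → ℝ) : Prop :=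
  ∃ m : MetricSpace A, (∀ x y : A, m.dist x y = rho s x y) ∧
    @CompleteSpace A m.toPseudoMetricSpace.toUniformSpace

/-- `(B, t)`, with the map `ι : A → B`, is a norm-completion of `(A, s)`: it is a state-complete
normed Riesz MV-algebra and `ι` is a norm-preserving embedding of Riesz MV-algebras with dense
range. -/
structure IsNormCompletion {B : Type*} [RieszMVOps B] (s : A → ℝ) (t : B → ℝ) (ι : A → B) :
    Prop where
  source : IsNormed s
  target : IsNormed t
  complete : IsStateComplete t
  hom : IsRieszMVHom ι
  injective : Function.Injective ι
  norm_map : ∀ a, t (ι a) = s a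
  dense : ∀ b : B, ∀ ε > 0, ∃ a : A, rho t (ι a) b < ε

end States

/-! ### The logic of Riesz MV-algebras -/

/-- Formulas with variables in `V`; the connectives are `¬`, `→` and `∇_r` for `r ∈ [0,1]`. -/
inductive Formula (V : Type*) where
  | var : V → Formula V
  | not : Formula V → Formula V
  | imp : Formula V → Formula V → Formula V
  | nabla : I → Formula V → Formula V

namespace Formula

variable {V : Type*}

/-- `φ ↔ ψ`, that is `(φ → ψ) ⊙ (ψ → φ)` with `α ⊙ β = ¬(α → ¬β)`. -/
def iff (φ ψ : Formula V) : Formula V := not (imp (imp φ ψ) (not (imp ψ φ)))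

/-- `Δ_r φ = ¬∇_r¬φ`. -/
def delta (r : I) (φ : Formula V) : Formula V := not (nabla r (not φ))

/-- Theorems: the four Łukasiewicz axioms, the axioms for `∇_r`, and modus ponens. -/
inductive Provable : Formula V → Prop
  | l1 (φ ψ) : Provable (imp φ (imp ψ φ))
  | l2 (φ ψ χ) : Provable (imp (imp φ ψ) (imp (imp ψ χ) (imp φ χ)))
  | l3 (φ ψ) : Provable (imp (imp (imp φ ψ) ψ) (imp (imp ψ φ) φ))
  | l4 (φ ψ) : Provable (imp (imp (not ψ) (not φ)) (imp φ ψ))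
  | r1 (r φ ψ) : Provable (iff (nabla r (imp φ ψ)) (imp (nabla r φ) (nabla r ψ)))
  | r2 (r q φ) : Provable (iff (nabla (odot r (neg q)) φ) (imp (nabla q φ) (nabla r φ)))
  | r3 (r q φ) : Provable (iff (nabla r (nabla q φ)) (nabla (r * q) φ))
  | r4 (φ) : Provable (iff (nabla 1 φ) φ)
  | mp {φ ψ} : Provable φ → Provable (imp φ ψ) → Provable ψ

/-- The value of a formula in the standard algebra `[0,1]`; `fun x => φ.eval x` is the term
function `f_φ` of `φ`.  As `Δ_r` is interpreted by multiplication by `r`, the value of `∇_r φ` is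
`(r φ*)*`. -/
noncomputable def eval (x : V → I) : Formula V → I
  | var v => x v
  | not φ => neg (eval x φ)
  | imp φ ψ => impl (eval x φ) (eval x ψ)
  | nabla r φ => neg (scal r (neg (eval x φ)))

namespace Provable

variable {φ ψ χ α β : Formula V}

theorem trans (h : Provable (imp φ ψ)) (k : Provable (imp ψ χ)) : Provable (imp φ χ) :=
  mp k (mp h (l2 _ _ _))

theorem exch (h : Provable (imp φ (imp ψ χ))) : Provable (imp ψ (imp φ χ)) :=
  trans (trans (l1 ψ (imp χ ψ)) (l3 χ ψ)) (mp h (l2 _ _ _))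

theorem id (φ : Formula V) : Provable (imp φ φ) :=
  mp (l1 φ φ) (exch (l1 φ (imp φ (imp φ φ))))

theorem exfalso (φ ψ : Formula V) : Provable (imp (not φ) (imp φ ψ)) :=
  trans (l1 _ _) (l4 _ _)

theorem not_not_elim (φ : Formula V) : Provable (imp (not (not φ)) φ) :=
  mp (id φ) (exch (trans (exfalso (not φ) (not (imp φ φ))) (l4 _ _)))

theorem not_not_intro (φ : Formula V) : Provable (imp φ (not (not φ))) :=
  mp (not_not_elim _) (l4 _ _)

theorem contra (h : Provable (imp φ ψ)) : Provable (imp (not ψ) (not φ)) :=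
  mp (trans (not_not_elim _) (trans h (not_not_intro _))) (l4 _ _)

theorem iff_left (h : Provable (iff φ ψ)) : Provable (imp φ ψ) :=
  mp h (trans (contra (exfalso _ _)) (not_not_elim _))

theorem iff_right (h : Provable (iff φ ψ)) : Provable (imp ψ φ) :=
  mp h (trans (contra (l1 _ _)) (not_not_elim _))

theorem imp_congr (h : Provable (imp α φ)) (k : Provable (imp ψ β)) :
    Provable (imp (imp φ ψ) (imp α β)) :=
  trans (mp h (l2 _ _ _)) (mp k (exch (l2 _ _ _)))

theorem nec (r : I) (h : Provable φ) : Provable (nabla r φ) := by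
  have e : odot r (neg (1 : I)) = odot r (neg r) := by
    apply Subtype.ext
    change 1 - min 1 (1 - (r : ℝ) + (1 - (1 - 1))) = 1 - min 1 (1 - (r : ℝ) + (1 - (1 - r)))
    rw [min_eq_left (by linarith [r.2.2]), min_eq_left (by linarith)]
  have h0 : Provable (nabla (odot r (neg 1)) φ) := e ▸ mp (id _) (iff_right (r2 r r φ))
  exact mp (mp h (iff_right (r4 φ))) (mp h0 (iff_left (r2 r 1 φ)))

theorem nabla_congr (r : I) (h : Provable (imp φ ψ)) : Provable (imp (nabla r φ) (nabla r ψ)) :=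
  mp (nec r h) (iff_left (r1 r φ ψ))

theorem impl_eq_one {a b : I} : impl a b = 1 ↔ a ≤ b := by
  rw [Subtype.ext_iff, ← Subtype.coe_le_coe]
  change min 1 (1 - (a : ℝ) + b) = 1 ↔ _
  rw [min_eq_left_iff]
  constructor <;> intro h <;> linarith

theorem eval_iff {x : V → I} (h : eval x φ = eval x ψ) : eval x (iff φ ψ) = 1 := by
  have h1 : impl (eval x φ) (eval x ψ) = 1 := impl_eq_one.2 h.le
  have h2 : impl (eval x ψ) (eval x φ) = 1 := impl_eq_one.2 h.ge
  simp only [iff, eval, h1, h2]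
  apply Subtype.ext
  change 1 - min 1 (1 - (1 : ℝ) + (1 - 1)) = 1
  norm_num

theorem sound (h : Provable φ) (x : V → I) : eval x φ = 1 := by
  induction h with
  | l1 φ ψ =>
    simp only [eval, impl_eq_one, ← Subtype.coe_le_coe]
    change _ ≤ min 1 (1 - (eval x ψ : ℝ) + eval x φ)
    exact le_min (eval x φ).2.2 (by linarith [(eval x ψ).2.2])
  | l2 φ ψ χ =>
    simp only [eval, impl_eq_one, ← Subtype.coe_le_coe]
    have := (eval x φ).2; have := (eval x ψ).2; have := (eval x χ).2
    change min 1 (1 - (eval x φ : ℝ) + eval x ψ) ≤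
      min 1 (1 - min 1 (1 - (eval x ψ : ℝ) + eval x χ) + min 1 (1 - (eval x φ : ℝ) + eval x χ))
    generalize (eval x φ : ℝ) = a at *
    generalize (eval x ψ : ℝ) = b at *
    generalize (eval x χ : ℝ) = c at *
    simp only [Set.mem_Icc] at *
    grind
  | l3 φ ψ =>
    simp only [eval, impl_eq_one, ← Subtype.coe_le_coe]
    have := (eval x φ).2; have := (eval x ψ).2
    change min 1 (1 - min 1 (1 - (eval x φ : ℝ) + eval x ψ) + eval x ψ) ≤
      min 1 (1 - min 1 (1 - (eval x ψ : ℝ) + eval x φ) + eval x φ)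
    generalize (eval x φ : ℝ) = a at *
    generalize (eval x ψ : ℝ) = b at *
    simp only [Set.mem_Icc] at *
    grind
  | l4 φ ψ =>
    simp only [eval, impl_eq_one, ← Subtype.coe_le_coe]
    change min 1 (1 - (1 - (eval x ψ : ℝ)) + (1 - eval x φ)) ≤ min 1 (1 - (eval x φ : ℝ) + eval x ψ)
    exact le_of_eq (by ring_nf)
  | r1 r φ ψ =>
    apply eval_iff
    apply Subtype.ext
    change 1 - (r : ℝ) * (1 - min 1 (1 - (eval x φ : ℝ) + eval x ψ)) =
      min 1 (1 - (1 - (r : ℝ) * (1 - eval x φ)) + (1 - (r : ℝ) * (1 - eval x ψ)))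
    have hr := r.2.1
    rcases le_total (eval x φ : ℝ) (eval x ψ) with h | h
    · rw [min_eq_left (by linarith), min_eq_left (by nlinarith)]; ring
    · rw [min_eq_right (by linarith), min_eq_right (by nlinarith)]; ring
  | r2 r q φ =>
    apply eval_iff
    apply Subtype.ext
    change 1 - (1 - min 1 (1 - (r : ℝ) + (1 - (1 - q)))) * (1 - (eval x φ : ℝ)) =
      min 1 (1 - (1 - (q : ℝ) * (1 - eval x φ)) + (1 - (r : ℝ) * (1 - eval x φ)))
    have hr := (eval x φ).2.2
    rcases le_total (r : ℝ) q with h | h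
    · rw [min_eq_left (by linarith), min_eq_left (by nlinarith)]; ring
    · rw [min_eq_right (by linarith), min_eq_right (by nlinarith)]; ring
  | r3 r q φ =>
    apply eval_iff
    apply Subtype.ext
    change 1 - (r : ℝ) * (1 - (1 - (q : ℝ) * (1 - eval x φ))) =
      1 - ((r : ℝ) * q) * (1 - eval x φ)
    ring
  | r4 φ =>
    apply eval_iff
    apply Subtype.ext
    change 1 - (1 : ℝ) * (1 - (eval x φ : ℝ)) = eval x φ
    ring
  | mp h k ih1 ih2 =>
    rw [eval, impl_eq_one, ih1] at ih2
    exact le_antisymm unitInterval.le_one' ih2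

theorem eval_eq (h : Provable (imp φ ψ)) (k : Provable (imp ψ φ)) (x : V → I) :
    eval x φ = eval x ψ :=
  le_antisymm (impl_eq_one.1 (sound h x)) (impl_eq_one.1 (sound k x))

end Provable

/-- Provable equivalence. -/
def setoid (V : Type*) : Setoid (Formula V) where
  r φ ψ := Provable (imp φ ψ) ∧ Provable (imp ψ φ)
  iseqv :=
    { refl := fun φ => ⟨Provable.id φ, Provable.id φ⟩
      symm := fun h => ⟨h.2, h.1⟩
      trans := fun h k => ⟨h.1.trans k.1, k.2.trans h.2⟩ }

end Formula

/-- The Lindenbaum-Tarski algebra `RL_n`: formulas in `n` variables up to provable equivalence. -/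
def RL (n : ℕ) : Type := Quotient (Formula.setoid (Fin n))

namespace RL

/-- The class `[φ]`. -/
def mk {n : ℕ} (φ : Formula (Fin n)) : RL n := Quotient.mk (Formula.setoid (Fin n)) φ

/-- `[φ] ⊕ [ψ] = [¬φ → ψ]`, `[φ]* = [¬φ]`, `0 = [¬(v → v)]`, `r[φ] = [Δ_r φ]`. -/
instance (n : ℕ) [NeZero n] : RieszMVOps (RL n) where
  oplus := Quotient.map₂ (fun φ ψ => .imp (.not φ) ψ) fun _ _ h _ _ k =>
    ⟨h.1.contra.imp_congr k.1, h.2.contra.imp_congr k.2⟩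
  neg := Quotient.map .not fun _ _ h => ⟨h.2.contra, h.1.contra⟩
  zero := mk (.not (.imp (.var 0) (.var 0)))
  scal r := Quotient.map (Formula.delta r) fun _ _ h =>
    ⟨(h.1.contra.nabla_congr r).contra, (h.2.contra.nabla_congr r).contra⟩

/-- `I([φ]) = ∫ f_φ(x) dx`, the integral over `[0,1]^n` with respect to Lebesgue measure. -/
noncomputable def integral (n : ℕ) : RL n → ℝ :=
  Quotient.lift (fun φ => ∫ x : Fin n → I, (φ.eval x : ℝ)) fun φ ψ h => by
    simp only [fun x => Formula.Provable.eval_eq h.1 h.2 x]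

end RL

/-! ### The algebra of `[0,1]`-valued integrable functions -/

/-- `L^1(μ)_u`, for `μ` the Lebesgue measure on `[0,1]^n`: the classes of integrable functions,
modulo equality almost everywhere, with values in `[0,1]`. -/
def L1u (n : ℕ) : Type :=
  {f : Lp ℝ 1 (volume : Measure (Fin n → I)) // ∀ᵐ x, f x ∈ Set.Icc (0 : ℝ) 1}

namespace L1u

/-- The operations are pointwise those of `[0,1]`: `f ⊕ g = min(1, f + g)`, `f* = 1 - f`, and
`r f` is the product. -/
noncomputable instance (n : ℕ) : RieszMVOps (L1u n) where
  oplus f g := ⟨Lp.const 1 volume (1 : ℝ) ⊓ (f.1 + g.1), by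
    filter_upwards [f.2, g.2, Lp.coeFn_inf (Lp.const 1 volume (1 : ℝ)) (f.1 + g.1),
      Lp.coeFn_add f.1 g.1, Lp.coeFn_const (p := 1) (μ := (volume : Measure (Fin n → I))) (1 : ℝ)]
      with x hf hg h1 h2 h3
    rw [h1, Pi.inf_apply, h2, h3, Pi.add_apply]
    exact ⟨le_inf zero_le_one (add_nonneg hf.1 hg.1), inf_le_left⟩⟩
  neg f := ⟨Lp.const 1 volume (1 : ℝ) - f.1, by
    filter_upwards [f.2, Lp.coeFn_sub (Lp.const 1 volume (1 : ℝ)) f.1,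
      Lp.coeFn_const (p := 1) (μ := (volume : Measure (Fin n → I))) (1 : ℝ)] with x hf h1 h2
    rw [h1, Pi.sub_apply, h2]
    exact ⟨sub_nonneg.2 hf.2, sub_le_self _ hf.1⟩⟩
  zero := ⟨0, by
    filter_upwards [Lp.coeFn_zero ℝ 1 (volume : Measure (Fin n → I))] with x h
    rw [h]
    exact ⟨le_rfl, zero_le_one⟩⟩
  scal r f := ⟨(r : ℝ) • f.1, by
    filter_upwards [f.2, Lp.coeFn_smul (r : ℝ) f.1] with x hf h
    rw [h, Pi.smul_apply, smul_eq_mul]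
    exact ⟨mul_nonneg r.2.1 hf.1, mul_le_one₀ r.2.2 hf.1 hf.2⟩⟩

/-- `s_μ(f) = ∫ f dμ`. -/
noncomputable def integral (n : ℕ) (f : L1u n) : ℝ := ∫ x, f.1 x

end L1u

end RMV

/-! Modulo provable equivalence a formula is its term function. This is completeness of the logic,
and it makes `RL n` an algebra of continuous functions on the cube. A nonempty open set has positive
measure, so such a function is determined by its class in `L1u n`. Thus `RL.toL1u` is an embedding,
and the state of `RL n` is the restriction of the one on `L1u n`.

Completeness: if `φ` is not provable, its class is not `1`, and `exists_prime_filter` gives a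
totally ordered quotient in which it still differs from `1`. Evaluating `φ` there involves finitely
many elements. A Hahn-Banach separation (`exists_dual_pos`, `exists_functional`) gives a function on
these elements that preserves order, disjoint sums and scalar multiples and is less than `1` at the
value of `φ`. In a chain an implication is either `1` or a disjoint sum, so this function carries
the evaluation of `φ` to an evaluation in `[0,1]` with value below `1` (`exists_eval_ne_one`).

Density: the functions `g` for which some `l g + 1/2`, `l > 0`, is a term function form a vector
lattice that interpolates at any two points. It is therefore dense in `C([0,1]^n)` by the lattice
form of Stone-Weierstrass, hence in `L^1`. The truncation of such a `g` to `[0,1]` is a term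
function, and truncating does not increase the distance to a `[0,1]`-valued function.

Completeness of `L1u n`: `ρ` is the `L^1` distance and `L1u n` is the closed order interval `[0,1]`
of `L^1`. Uniqueness: the operations are Lipschitz for `ρ`, so the isometry between two completions
that fixes the dense copy of `RL n` preserves all the structure. -/

namespace RMV

/-! ### Elementary theory of Riesz MV-algebras -/

section Algebra

local infixl:65 " ⊕ₘ " => oplus
local infixl:70 " ⊙ₘ " => odot
local prefix:max "∼" => neg

namespace MV

variable {A : Type*} [RieszMVOps A] [hA : Fact (IsRieszMVAlgebra A)]

theorem oplus_assoc (x y z : A) : x ⊕ₘ y ⊕ₘ z = x ⊕ₘ (y ⊕ₘ z) := hA.out.oplus_assoc x y z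

theorem oplus_comm (x y : A) : x ⊕ₘ y = y ⊕ₘ x := hA.out.oplus_comm x y

theorem oplus_left_comm (x y z : A) : x ⊕ₘ (y ⊕ₘ z) = y ⊕ₘ (x ⊕ₘ z) := by
  rw [← oplus_assoc, oplus_comm x, oplus_assoc]

theorem oplus_zero (x : A) : x ⊕ₘ zero = x := hA.out.oplus_zero x

theorem zero_oplus (x : A) : zero ⊕ₘ x = x := by rw [oplus_comm, oplus_zero]

theorem neg_neg (x : A) : ∼(∼x) = x := hA.out.neg_neg x

theorem neg_one : ∼(one : A) = zero := neg_neg _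

theorem one_oplus (x : A) : one ⊕ₘ x = one := hA.out.neg_zero_oplus x

theorem oplus_one (x : A) : x ⊕ₘ one = one := by rw [oplus_comm, one_oplus]

theorem neg_oplus_self (x : A) : ∼x ⊕ₘ x = one := by
  have h := hA.out.lukasiewicz x one
  rw [oplus_one, neg_one, zero_oplus] at h
  exact h.symm

theorem oplus_neg_self (x : A) : x ⊕ₘ ∼x = one := by rw [oplus_comm, neg_oplus_self]

theorem neg_injective {x y : A} (h : ∼x = ∼y) : x = y := by
  rw [← neg_neg x, h, neg_neg]

theorem neg_odot (x y : A) : ∼(x ⊙ₘ y) = ∼x ⊕ₘ ∼y := neg_neg _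

theorem neg_oplus (x y : A) : ∼(x ⊕ₘ y) = ∼x ⊙ₘ ∼y := by
  rw [odot, neg_neg, neg_neg]

theorem odot_comm (x y : A) : x ⊙ₘ y = y ⊙ₘ x := by
  rw [odot, oplus_comm, ← odot]

theorem odot_assoc (x y z : A) : x ⊙ₘ y ⊙ₘ z = x ⊙ₘ (y ⊙ₘ z) := by
  apply neg_injective
  simp only [neg_odot, oplus_assoc]

theorem odot_one (x : A) : x ⊙ₘ one = x := by
  rw [odot, neg_one, oplus_zero, neg_neg]

theorem one_odot (x : A) : one ⊙ₘ x = x := by rw [odot_comm, odot_one]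

theorem odot_neg_self (x : A) : x ⊙ₘ ∼x = zero := by
  rw [odot, neg_neg, neg_oplus_self, neg_one]

theorem neg_odot_self (x : A) : ∼x ⊙ₘ x = zero := by rw [odot_comm, odot_neg_self]

/-- The natural order of an MV-algebra. -/
@[reducible]
def partialOrder (A : Type*) [RieszMVOps A] [hA : Fact (IsRieszMVAlgebra A)] : PartialOrder A where
  le x y := ∼x ⊕ₘ y = one
  le_refl := neg_oplus_self
  le_trans x y z h k := by
    have e : z = y ⊕ₘ ∼(∼z ⊕ₘ y) := by
      have := hA.out.lukasiewicz y z
      rw [k, neg_one, zero_oplus] at this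
      rw [oplus_comm y]; exact this
    rw [e, ← oplus_assoc, h, one_oplus]
  le_antisymm x y h k := by
    have := hA.out.lukasiewicz x y
    rw [h, k, neg_one, zero_oplus, zero_oplus] at this
    exact this.symm

attribute [local instance] partialOrder

theorem le_def {x y : A} : x ≤ y ↔ ∼x ⊕ₘ y = one := Iff.rfl

theorem le_one (x : A) : x ≤ one := oplus_one _

theorem zero_le (x : A) : zero ≤ x := one_oplus x

theorem odot_neg_eq_zero {x y : A} : x ⊙ₘ ∼y = zero ↔ x ≤ y := by
  rw [le_def, ← neg_one, odot, neg_neg]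
  exact ⟨neg_injective, congrArg _⟩

theorem odot_eq_zero {x y : A} : x ⊙ₘ y = zero ↔ x ≤ ∼y := by
  rw [← odot_neg_eq_zero, neg_neg]

theorem le_oplus_left (x y : A) : x ≤ x ⊕ₘ y := by
  rw [le_def, ← oplus_assoc, neg_oplus_self, one_oplus]

theorem le_oplus_right (x y : A) : y ≤ x ⊕ₘ y := oplus_comm y x ▸ le_oplus_left y x

/-- With `∼x ⊕ y = 1` the Łukasiewicz law reads `y = (y ⊙ ∼x) ⊕ x`: the order is divisibility for
`⊕`, and `y ⊙ ∼x` plays the role of `y - x`. -/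
theorem oplus_odot_neg {x y : A} (h : x ≤ y) : x ⊕ₘ y ⊙ₘ ∼x = y := by
  have := hA.out.lukasiewicz x y
  rw [h, neg_one, zero_oplus] at this
  rw [odot, neg_neg, oplus_comm]; exact this.symm

theorem neg_le_neg {x y : A} (h : x ≤ y) : ∼y ≤ ∼x := by
  rw [le_def, neg_neg, oplus_comm]; exact h

theorem neg_le_comm {x y : A} : ∼x ≤ y ↔ ∼y ≤ x := by
  rw [le_def, neg_neg, le_def, neg_neg, oplus_comm]

theorem le_neg_comm {x y : A} : x ≤ ∼y ↔ y ≤ ∼x := by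
  rw [le_def, le_def, oplus_comm]

theorem oplus_le_oplus {x y z w : A} (h : x ≤ y) (k : z ≤ w) : x ⊕ₘ z ≤ y ⊕ₘ w := by
  rw [← oplus_odot_neg h, ← oplus_odot_neg k]
  have : x ⊕ₘ y ⊙ₘ ∼x ⊕ₘ (z ⊕ₘ w ⊙ₘ ∼z) = x ⊕ₘ z ⊕ₘ (y ⊙ₘ ∼x ⊕ₘ w ⊙ₘ ∼z) := by
    simp only [oplus_assoc, oplus_left_comm z]
  rw [this]
  exact le_oplus_left _ _

theorem odot_le_odot {x y z w : A} (h : x ≤ y) (k : z ≤ w) : x ⊙ₘ z ≤ y ⊙ₘ w :=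
  neg_le_neg (oplus_le_oplus (neg_le_neg h) (neg_le_neg k))

theorem odot_le_left (x y : A) : x ⊙ₘ y ≤ x := by
  simpa only [odot_one] using odot_le_odot (le_refl x) (le_one y)

theorem odot_le_right (x y : A) : x ⊙ₘ y ≤ y := odot_comm y x ▸ odot_le_left y x

/-- Residuation. -/
theorem odot_le_iff {x y z : A} : x ⊙ₘ y ≤ z ↔ x ≤ ∼y ⊕ₘ z := by
  rw [le_def, neg_odot, oplus_assoc, le_def]

/-- Residuation for the truncated difference. -/
theorem odot_neg_le_iff {x y z : A} : x ⊙ₘ ∼y ≤ z ↔ x ≤ y ⊕ₘ z := by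
  rw [odot_le_iff, neg_neg]

/-- The join. -/
def sup (x y : A) : A := x ⊙ₘ ∼y ⊕ₘ y

theorem sup_comm (x y : A) : sup x y = sup y x := by
  simpa only [sup, odot, neg_neg] using hA.out.lukasiewicz x y

theorem le_sup_right (x y : A) : y ≤ sup x y := le_oplus_right _ _

theorem le_sup_left (x y : A) : x ≤ sup x y := sup_comm y x ▸ le_sup_right y x

theorem sup_eq_right {x y : A} (h : x ≤ y) : sup x y = y := by
  rw [sup, odot_neg_eq_zero.2 h, zero_oplus]

theorem sup_eq_left {x y : A} (h : y ≤ x) : sup x y = x := by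
  rw [sup_comm, sup_eq_right h]

theorem sup_le {x y z : A} (h : x ≤ z) (k : y ≤ z) : sup x y ≤ z := by
  rw [← sup_eq_left k]
  exact oplus_le_oplus (odot_le_odot h le_rfl) le_rfl

theorem sup_le_sup {x y z w : A} (h : x ≤ y) (k : z ≤ w) : sup x z ≤ sup y w :=
  sup_le (h.trans (le_sup_left _ _)) (k.trans (le_sup_right _ _))

theorem odot_sup_le {x y z w : A} (h : x ⊙ₘ y ≤ w) (k : x ⊙ₘ z ≤ w) : x ⊙ₘ sup y z ≤ w := by
  rw [odot_comm, odot_le_iff] at *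
  exact sup_le h k

/-- The meet. -/
def inf (x y : A) : A := x ⊙ₘ (∼x ⊕ₘ y)

theorem inf_eq (x y : A) : inf x y = ∼(sup ∼y ∼x) := by
  rw [inf, sup, neg_oplus, neg_odot, neg_neg, neg_neg, neg_neg, odot_comm, oplus_comm]

theorem inf_comm (x y : A) : inf x y = inf y x := by rw [inf_eq, sup_comm, ← inf_eq]

theorem inf_le_left (x y : A) : inf x y ≤ x := odot_le_left _ _

theorem inf_le_right (x y : A) : inf x y ≤ y := inf_comm y x ▸ inf_le_left y x

theorem le_inf {x y z : A} (h : z ≤ x) (k : z ≤ y) : z ≤ inf x y := by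
  rw [inf_eq, le_neg_comm]
  exact sup_le (neg_le_neg k) (neg_le_neg h)

theorem inf_eq_right {x y : A} (h : y ≤ x) : inf x y = y :=
  le_antisymm (inf_le_right _ _) (le_inf h le_rfl)

theorem inf_oplus (x y : A) : inf x y ⊕ₘ x ⊙ₘ ∼y = x := by
  have h : inf x y = x ⊙ₘ ∼(x ⊙ₘ ∼y) := by rw [inf, neg_odot, neg_neg]
  rw [h, ← sup, sup_eq_left (odot_le_left _ _)]

/-- The positive parts of `x - y` and `y - x` are disjoint. With `w = x ∧ y`, both `x = w ⊕ (x ⊙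
∼y)` and its mirror image give `w ⊕ m ≤ w`; since also `m ≤ ∼w`, `m` is at most `∼w ⊙ (w ⊕ m) ≤ ∼w ⊙
w = 0`. -/
theorem eq_zero_of_le_of_le {m x y : A} (h : m ≤ x ⊙ₘ ∼y) (k : m ≤ y ⊙ₘ ∼x) : m = zero := by
  set w := inf x y with hw
  have hx : w ⊕ₘ m ≤ x := (oplus_le_oplus le_rfl h).trans_eq (inf_oplus x y)
  have hy : w ⊕ₘ m ≤ y := by
    rw [hw, inf_comm]
    exact (oplus_le_oplus le_rfl k).trans_eq (inf_oplus y x)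
  have hm : m ≤ ∼w := h.trans ((odot_le_right _ _).trans (neg_le_neg (inf_le_right _ _)))
  have := le_inf hm (le_refl m)
  rw [inf, neg_neg] at this
  refine le_antisymm (this.trans ?_) (zero_le _)
  rw [← neg_odot_self w]
  exact odot_le_odot le_rfl (le_inf hx hy)

/-- Prelinearity. -/
theorem sup_impl_impl (x y : A) : sup (∼x ⊕ₘ y) (∼y ⊕ₘ x) = one := by
  apply neg_injective
  rw [neg_one]
  apply eq_zero_of_le_of_le (x := x) (y := y)
  · rw [neg_le_comm, neg_odot, neg_neg]; exact le_sup_left _ _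
  · rw [neg_le_comm, neg_odot, neg_neg]; exact le_sup_right _ _

/-- This inequality is what makes `{x | a ∨ x ∈ F}` closed under `⊙` when `F` is a filter. -/
theorem sup_odot_sup_le (x y z : A) : sup x y ⊙ₘ sup x z ≤ sup x (y ⊙ₘ z) := by
  apply odot_sup_le
  · exact (odot_le_right _ _).trans (le_sup_left _ _)
  · rw [odot_comm]
    apply odot_sup_le
    · exact (odot_le_right _ _).trans (le_sup_left _ _)
    · rw [odot_comm]; exact le_sup_right _ _

/-! ### Disjoint sums and scalars -/

/-- When `x ⊙ y = 0` the sum is not truncated, so subtracting `y` recovers `x`: disjoint sums behave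
like addition in an ordered group. -/
theorem oplus_odot_neg_cancel {x y : A} (h : x ⊙ₘ y = zero) : (x ⊕ₘ y) ⊙ₘ ∼y = x := by
  have := inf_eq_right (odot_eq_zero.1 h)
  rw [inf, neg_neg] at this
  rw [odot_comm, oplus_comm x y, this]

theorem oplus_right_cancel {x y z : A} (h : x ⊙ₘ z = zero) (k : y ⊙ₘ z = zero)
    (e : x ⊕ₘ z = y ⊕ₘ z) : x = y := by
  rw [← oplus_odot_neg_cancel h, e, oplus_odot_neg_cancel k]

theorem odot_eq_zero_of_le {x y z w : A} (h : x ≤ y) (k : z ≤ w) (e : y ⊙ₘ w = zero) :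
    x ⊙ₘ z = zero :=
  le_antisymm (e ▸ odot_le_odot h k) (zero_le _)

theorem oplus_lt_oplus_of_le_of_lt {x y z w : A} (h : x ≤ y) (k : z < w) (e : y ⊙ₘ w = zero) :
    x ⊕ₘ z < y ⊕ₘ w := by
  refine lt_of_le_of_lt (oplus_le_oplus h le_rfl)
    (lt_of_le_of_ne (oplus_le_oplus le_rfl k.le) fun h' => k.ne ?_)
  rw [oplus_comm y, oplus_comm y] at h'
  rw [odot_comm] at e
  exact oplus_right_cancel (odot_eq_zero_of_le k.le le_rfl e) e h'

theorem oplus_lt_oplus_of_lt_of_le {x y z w : A} (h : x < y) (k : z ≤ w) (e : y ⊙ₘ w = zero) :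
    x ⊕ₘ z < y ⊕ₘ w := by
  rw [oplus_comm x, oplus_comm y]
  exact oplus_lt_oplus_of_le_of_lt k h (odot_comm y w ▸ e)

theorem coe_odot_neg (r q : I) : ((odot r (neg q) : I) : ℝ) = max 0 ((r : ℝ) - q) := by
  change 1 - min 1 (1 - (r : ℝ) + (1 - (1 - q))) = _
  grind

theorem scal_odot_neg (r : I) (x y : A) : scal r (x ⊙ₘ ∼y) = scal r x ⊙ₘ ∼(scal r y) :=
  hA.out.scal_odot r x y

theorem scal_scal (r q : I) (x : A) : scal r (scal q x) = scal (r * q) x := hA.out.scal_scal r q x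

theorem one_scal (x : A) : scal 1 x = x := hA.out.one_scal x

theorem scal_odot_scalar {r q t : I} (h : (t : ℝ) = max 0 ((r : ℝ) - q)) (x : A) :
    scal t x = scal r x ⊙ₘ ∼(scal q x) := by
  rw [← hA.out.scal_odot_scalar]
  congr 1
  exact Subtype.ext (h.trans (coe_odot_neg r q).symm)

theorem zero_scal (x : A) : scal 0 x = zero := by
  rw [scal_odot_scalar (r := 0) (q := 0) (by simp), odot_neg_self]

theorem scal_zero (r : I) : scal r (zero : A) = zero := by
  rw [← odot_neg_self zero, scal_odot_neg, odot_neg_self, odot_neg_self]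

theorem scal_le_scal_left {r q : I} (h : r ≤ q) (x : A) : scal r x ≤ scal q x := by
  rw [← odot_neg_eq_zero, ← scal_odot_scalar (t := 0), zero_scal]
  rw [max_eq_left (sub_nonpos.2 (by exact_mod_cast h))]; rfl

theorem scal_le_self (r : I) (x : A) : scal r x ≤ x :=
  (scal_le_scal_left r.2.2 x).trans_eq (one_scal x)

theorem scal_le_scal (r : I) {x y : A} (h : x ≤ y) : scal r x ≤ scal r y := by
  rw [← odot_neg_eq_zero, ← scal_odot_neg, odot_neg_eq_zero.2 h, scal_zero]

/-- The axioms only distribute scalars over differences. Writing `x` as `(x ⊕ y) ⊙ ∼y` turns the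
right side into `r(x ⊕ y) ∨ r y`, which is `r(x ⊕ y)`. -/
theorem scal_oplus (r : I) {x y : A} (h : x ⊙ₘ y = zero) :
    scal r (x ⊕ₘ y) = scal r x ⊕ₘ scal r y := by
  nth_rw 2 [← oplus_odot_neg_cancel h]
  rw [scal_odot_neg, ← sup, sup_eq_left (scal_le_scal r (le_oplus_right x y))]

theorem add_scal {r q t : I} (h : (t : ℝ) = r + q) (x : A) :
    scal t x = scal r x ⊕ₘ scal q x := by
  have hq : q ≤ t := Subtype.coe_le_coe.1 (by linarith [r.2.1])
  rw [scal_odot_scalar (t := r) (r := t) (q := q), ← sup, sup_eq_left (scal_le_scal_left hq x)]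
  rw [h, add_sub_cancel_right, max_eq_right r.2.1]

/-- Weights of total at most one never cause truncation. By monotonicity only `x = y = 1` matters,
and there `∼(q 1) = (1 - q) 1 ≥ r 1`. -/
theorem scal_odot_scal_eq_zero {r q : I} (h : (r : ℝ) + q ≤ 1) (x y : A) :
    scal r x ⊙ₘ scal q y = zero := by
  refine odot_eq_zero_of_le (scal_le_scal r (le_one x)) (scal_le_scal q (le_one y)) ?_
  have : scal (σ q) (one : A) = ∼(scal q one) := by
    rw [scal_odot_scalar (r := 1) (q := q), one_scal, one_odot]
    rw [coe_symm_eq, max_eq_right (by simpa using q.2.2)]; rfl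
  rw [odot_eq_zero, ← this]
  refine scal_le_scal_left (Subtype.coe_le_coe.1 ?_) _
  rw [coe_symm_eq]; linarith

theorem eq_zero_of_scal_eq_zero {r : I} (hr : 0 < r) {x : A} (h : scal r x = zero) :
    x = zero := by
  -- Archimedean argument: `q x` vanishes for all `q ≤ k r`, by removing one copy of `r` at a time,
  -- and `k r` eventually exceeds `1`.
  have key : ∀ k : ℕ, ∀ q : I, (q : ℝ) ≤ k * r → scal q x = zero := by
    intro k
    induction k with
    | zero =>
      intro q hq
      have : q = 0 := le_antisymm (Subtype.coe_le_coe.1 (by simpa using hq)) q.2.1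
      rw [this, zero_scal]
    | succ k ih =>
      intro q hq
      rcases le_total q r with hqr | hqr
      · exact le_antisymm (h ▸ scal_le_scal_left hqr x) (zero_le _)
      · have hqr' : (r : ℝ) ≤ q := hqr
        have hp : (q : ℝ) - r ∈ Set.Icc (0 : ℝ) 1 :=
          ⟨by linarith, by linarith [q.2.2, r.2.1]⟩
        rw [add_scal (r := ⟨(q : ℝ) - r, hp⟩) (q := r) (by simp), h, ih, oplus_zero]
        push_cast at hq
        change (q : ℝ) - r ≤ _
        linarith
  obtain ⟨k, hk⟩ := exists_nat_gt ((1 : ℝ) / r)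
  have hr' : (0 : ℝ) < r := hr
  rw [← one_scal x]
  refine key k 1 ?_
  rw [div_lt_iff₀ hr'] at hk
  exact hk.le

theorem scal_lt_scal {r : I} (hr : 0 < r) {x y : A} (h : x < y) : scal r x < scal r y := by
  refine lt_of_le_not_ge (scal_le_scal r h.le) fun h' => h.not_ge ?_
  rw [← odot_neg_eq_zero, ← scal_odot_neg] at h'
  exact odot_neg_eq_zero.1 (eq_zero_of_scal_eq_zero hr h')

/-! ### States -/

theorem state_eq_add {t : A → ℝ} (ht : IsState t) {x y : A} (h : x ≤ y) :
    t y = t x + t (y ⊙ₘ ∼x) := by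
  rw [← ht.map_oplus, oplus_odot_neg h]
  rw [odot_comm, odot_assoc, neg_odot_self, odot_eq_zero]
  exact (neg_one (A := A) ▸ neg_neg (one : A)) ▸ le_one y

theorem state_mono {t : A → ℝ} (ht : IsState t) {x y : A} (h : x ≤ y) : t x ≤ t y := by
  rw [state_eq_add ht h]; linarith [(ht.mem_Icc (y ⊙ₘ ∼x)).1]

/-- The state is the distance to `0`, which later gives its continuity. -/
theorem rho_zero (t : A → ℝ) (x : A) : rho t x zero = t x := by
  have h : ∼x ⊙ₘ zero = zero := le_antisymm (odot_le_right _ _) (zero_le _)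
  rw [rho, h, oplus_zero]
  change t (x ⊙ₘ one) = _
  rw [odot_one]

theorem rho_neg (t : A → ℝ) (x y : A) : rho t ∼x ∼y = rho t x y := by
  rw [rho, rho, neg_neg, neg_neg, oplus_comm]

theorem oplus_odot_neg_oplus_le (x y z : A) : (x ⊕ₘ y) ⊙ₘ ∼(x ⊕ₘ z) ≤ y ⊙ₘ ∼z := by
  rw [odot_neg_le_iff, oplus_assoc]
  refine oplus_le_oplus le_rfl ?_
  rw [oplus_comm]
  exact le_sup_left _ _

theorem rho_oplus_le {t : A → ℝ} (ht : IsState t) (x y z : A) :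
    rho t (x ⊕ₘ y) (x ⊕ₘ z) ≤ rho t y z := by
  refine state_mono ht (oplus_le_oplus (oplus_odot_neg_oplus_le x y z) ?_)
  rw [odot_comm, odot_comm ∼y]
  exact oplus_odot_neg_oplus_le x z y

theorem rho_scal_le {t : A → ℝ} (ht : IsState t) (r : I) (x y : A) :
    rho t (scal r x) (scal r y) ≤ rho t x y := by
  refine state_mono ht (oplus_le_oplus ?_ ?_)
  · rw [← scal_odot_neg]; exact scal_le_self _ _
  · rw [odot_comm, ← scal_odot_neg, odot_comm ∼x]; exact scal_le_self _ _

end MV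

end Algebra

/-! ### Prime filters and totally ordered quotients -/

section Filter

local infixl:65 " ⊕ₘ " => oplus
local infixl:70 " ⊙ₘ " => odot
local prefix:max "∼" => neg

namespace MV

universe u

variable {A : Type u} [RieszMVOps A] [hA : Fact (IsRieszMVAlgebra A)]

attribute [local instance] partialOrder

/-- Filters (implicative filters) of an MV-algebra. -/
structure IsFilter (F : Set A) : Prop where
  one_mem : one ∈ F
  mp : ∀ {x y : A}, x ∈ F → impl x y ∈ F → y ∈ F

namespace IsFilter

variable {F : Set A} (hF : IsFilter F)

include hF

theorem mem_of_le {x y : A} (h : x ≤ y) (hx : x ∈ F) : y ∈ F :=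
  hF.mp hx (by rw [impl, le_def.1 h]; exact hF.one_mem)

theorem odot_mem {x y : A} (hx : x ∈ F) (hy : y ∈ F) : x ⊙ₘ y ∈ F :=
  hF.mp hy (hF.mem_of_le (odot_le_iff.1 le_rfl) hx)

theorem sup_preimage (a : A) : IsFilter {x | sup a x ∈ F} where
  one_mem := hF.mem_of_le (le_sup_right _ _) hF.one_mem
  mp {x y} hx hxy := by
    refine hF.mem_of_le ?_ (hF.odot_mem hx hxy)
    refine (sup_odot_sup_le _ _ _).trans (sup_le_sup le_rfl ?_)
    rw [odot_comm, odot_le_iff]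
    exact le_rfl

theorem subset_sup_preimage (a : A) : F ⊆ {x | sup a x ∈ F} :=
  fun _ => hF.mem_of_le (le_sup_right _ _)

theorem impl_trans {x y z : A} (h : impl x y ∈ F) (k : impl y z ∈ F) : impl x z ∈ F := by
  refine hF.mem_of_le ?_ (hF.odot_mem k h)
  rw [impl, impl, impl, oplus_comm ∼x z, ← neg_neg z, oplus_comm _ ∼x, ← odot_le_iff]
  rw [odot_assoc, neg_neg, odot_le_iff]
  have h1 : (∼x ⊕ₘ y) ⊙ₘ x ≤ y := odot_le_iff.2 le_rfl
  exact (le_of_eq (oplus_comm _ _)).trans ((oplus_le_oplus le_rfl (neg_le_neg h1)).trans_eq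
    (oplus_comm _ _))

theorem impl_oplus_right {x y : A} (z : A) (h : impl x y ∈ F) :
    impl (x ⊕ₘ z) (y ⊕ₘ z) ∈ F := by
  refine hF.mem_of_le ?_ h
  have : impl (x ⊕ₘ z) (y ⊕ₘ z) = sup ∼x z ⊕ₘ y := by
    rw [impl, sup, neg_oplus, oplus_comm y, oplus_assoc]
  rw [this]
  exact oplus_le_oplus (le_sup_left _ _) le_rfl

theorem impl_oplus {x y z w : A} (h : impl x y ∈ F) (k : impl z w ∈ F) :
    impl (x ⊕ₘ z) (y ⊕ₘ w) ∈ F := by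
  refine hF.impl_trans (hF.impl_oplus_right z h) ?_
  rw [oplus_comm y, oplus_comm y]
  exact hF.impl_oplus_right y k

theorem impl_scal (r : I) {x y : A} (h : impl x y ∈ F) :
    impl (scal r x) (scal r y) ∈ F := by
  refine hF.mem_of_le ?_ h
  have e (x y : A) : impl x y = ∼(x ⊙ₘ ∼y) := by rw [neg_odot, neg_neg, impl]
  rw [e, e, ← scal_odot_neg]
  exact neg_le_neg (scal_le_self r _)

/-- The congruence of a filter. -/
@[reducible]
def setoid : Setoid A where
  r x y := impl x y ∈ F ∧ impl y x ∈ F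
  iseqv :=
    { refl := fun x => by
        have : impl x x ∈ F := by rw [impl, neg_oplus_self]; exact hF.one_mem
        exact ⟨this, this⟩
      symm := fun h => ⟨h.2, h.1⟩
      trans := fun h k => ⟨hF.impl_trans h.1 k.1, hF.impl_trans k.2 h.2⟩ }

/-- The operations of the quotient by a filter. -/
@[reducible]
def quotientOps : RieszMVOps (Quotient hF.setoid) where
  oplus := Quotient.map₂ oplus fun _ _ h _ _ k =>
    ⟨hF.impl_oplus h.1 k.1, hF.impl_oplus h.2 k.2⟩
  neg := Quotient.map neg fun x y h => by
    have e (x y : A) : impl ∼x ∼y = impl y x := by rw [impl, neg_neg, oplus_comm, impl]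
    exact ⟨(e x y).symm ▸ h.2, (e y x).symm ▸ h.1⟩
  zero := Quotient.mk _ zero
  scal r := Quotient.map (scal r) fun _ _ h => ⟨hF.impl_scal r h.1, hF.impl_scal r h.2⟩

theorem exists_quotient : ∃ (L : Type u) (_ : RieszMVOps L) (π : A → L), IsRieszMVAlgebra L ∧
    IsRieszMVHom π ∧ Function.Surjective π ∧ ∀ x, π x = one ↔ x ∈ F := by
  let := hF.setoid
  let := hF.quotientOps
  refine ⟨Quotient hF.setoid, inferInstance, Quotient.mk _, ?_, ?_, Quotient.mk_surjective, ?_⟩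
  · constructor
    · rintro ⟨x⟩ ⟨y⟩ ⟨z⟩; exact congrArg (Quotient.mk _) (oplus_assoc x y z)
    · rintro ⟨x⟩ ⟨y⟩; exact congrArg (Quotient.mk _) (oplus_comm x y)
    · rintro ⟨x⟩; exact congrArg (Quotient.mk _) (oplus_zero x)
    · rintro ⟨x⟩; exact congrArg (Quotient.mk _) (neg_neg x)
    · rintro ⟨x⟩ ⟨y⟩; exact congrArg (Quotient.mk _) (hA.out.lukasiewicz x y)
    · rintro ⟨x⟩; exact congrArg (Quotient.mk _) (one_oplus x)
    · rintro r ⟨x⟩ ⟨y⟩; exact congrArg (Quotient.mk _) (scal_odot_neg r x y)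
    · rintro r q ⟨x⟩; exact congrArg (Quotient.mk _) (hA.out.scal_odot_scalar r q x)
    · rintro r q ⟨x⟩; exact congrArg (Quotient.mk _) (scal_scal r q x)
    · rintro ⟨x⟩; exact congrArg (Quotient.mk _) (one_scal x)
  · exact ⟨fun _ _ => rfl, fun _ => rfl, rfl, fun _ _ => rfl⟩
  · intro x
    change Quotient.mk _ x = Quotient.mk _ one ↔ _
    rw [Quotient.eq]
    change impl x one ∈ F ∧ impl one x ∈ F ↔ _
    rw [impl, impl, oplus_one, neg_one, zero_oplus]
    exact and_iff_right hF.one_mem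

end IsFilter

/-- The prime filter theorem. -/
theorem exists_prime_filter {z : A} (hz : z ≠ one) :
    ∃ F : Set A, IsFilter F ∧ z ∉ F ∧ ∀ x y : A, impl x y ∈ F ∨ impl y x ∈ F := by
  -- Zorn's lemma, starting from the filter `{1}`, gives a filter maximal among those that avoid
  -- `z`; maximality forces primeness.
  obtain ⟨F, -, hF⟩ := zorn_subset_nonempty {F : Set A | IsFilter F ∧ z ∉ F} (by
      intro c hc hchain hne
      refine ⟨⋃₀ c, ⟨⟨?_, ?_⟩, ?_⟩, fun s hs => Set.subset_sUnion_of_mem hs⟩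
      · obtain ⟨s, hs⟩ := hne
        exact ⟨s, hs, (hc hs).1.one_mem⟩
      · rintro x y ⟨s, hs, hx⟩ ⟨t, ht, hxy⟩
        rcases hchain.total hs ht with h | h
        · exact ⟨t, ht, (hc ht).1.mp (h hx) hxy⟩
        · exact ⟨s, hs, (hc hs).1.mp hx (h hxy)⟩
      · rintro ⟨s, hs, h⟩
        exact (hc hs).2 h) {one} ⟨⟨rfl, fun {x y} hx hxy => by
          rw [Set.mem_singleton_iff] at *
          rwa [hx, impl, neg_one, zero_oplus] at hxy⟩, hz⟩
  obtain ⟨⟨hf, hzF⟩, hmax⟩ := hF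
  refine ⟨F, hf, hzF, fun x y => ?_⟩
  by_contra! hcon
  -- Otherwise `{w | (x → y) ∨ w ∈ F}` is a filter avoiding `z`, so by maximality it lies in `F`;
  -- but prelinearity puts `y → x` in it. Once this is known, `{w | z ∨ w ∈ F}`, which avoids `z`
  -- because `z ∨ z = z`, lies in `F` as well and contains `x → y`.
  have h1 : sup (impl x y) z ∈ F := by
    by_contra h
    have := hmax ⟨hf.sup_preimage (impl x y), h⟩ (hf.subset_sup_preimage _)
    refine hcon.2 (this ?_)
    change sup _ _ ∈ F
    rw [impl, impl, sup_impl_impl]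
    exact hf.one_mem
  have h2 : z ∉ {w | sup z w ∈ F} := by
    change sup z z ∉ F
    rwa [sup_eq_right le_rfl]
  refine hcon.1 (hmax ⟨hf.sup_preimage z, h2⟩ (hf.subset_sup_preimage _) ?_)
  change sup _ _ ∈ F
  rwa [sup_comm]

theorem _root_.RMV.IsRieszMVHom.map_one {A B : Type*} [RieszMVOps A] [RieszMVOps B] {f : A → B}
    (hf : IsRieszMVHom f) : f one = one := by
  rw [one, hf.map_neg, hf.map_zero, ← one]

theorem _root_.RMV.IsRieszMVHom.map_impl {A B : Type*} [RieszMVOps A] [RieszMVOps B] {f : A → B}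
    (hf : IsRieszMVHom f) (x y : A) : f (impl x y) = impl (f x) (f y) := by
  rw [impl, hf.map_oplus, hf.map_neg, ← impl]

/-- An element different from `1` remains so in some totally ordered quotient. -/
theorem exists_chain_quotient {z : A} (hz : z ≠ one) :
    ∃ (L : Type u) (_ : RieszMVOps L) (π : A → L), IsRieszMVAlgebra L ∧ IsRieszMVHom π ∧
      (∀ x y : L, impl x y = one ∨ impl y x = one) ∧ π z ≠ one := by
  obtain ⟨F, hF, hzF, hprime⟩ := exists_prime_filter hz
  obtain ⟨L, _, π, hL, hπ, hsurj, hone⟩ := hF.exists_quotient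
  refine ⟨L, _, π, hL, hπ, fun x y => ?_, fun h => hzF ((hone z).1 h)⟩
  obtain ⟨x, rfl⟩ := hsurj x
  obtain ⟨y, rfl⟩ := hsurj y
  rw [← hπ.map_impl, ← hπ.map_impl, hone, hone]
  exact hprime x y

end MV

end Filter

/-! ### Linear functionals on finite subsets of a Riesz MV-algebra -/

section Functional

local infixl:65 " ⊕ₘ " => oplus
local infixl:70 " ⊙ₘ " => odot
local prefix:max "∼" => neg

namespace MV

variable {A : Type*} [RieszMVOps A] [hA : Fact (IsRieszMVAlgebra A)]

attribute [local instance] partialOrder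

/-- The truncation of a real number to `[0,1]`. -/
noncomputable def clip (r : ℝ) : I := Set.projIcc 0 1 zero_le_one r

theorem coe_clip {r : ℝ} (h0 : 0 ≤ r) (h1 : r ≤ 1) : (clip r : ℝ) = r := by
  rw [clip, Set.projIcc_of_mem _ ⟨h0, h1⟩]

theorem clip_coe (r : I) : clip r = r := Set.projIcc_val _ r

theorem clip_zero : clip 0 = 0 := clip_coe 0

/-- The commutative monoid `(A, ⊕, 0)`. -/
@[reducible]
def addCommMonoid (A : Type*) [RieszMVOps A] [hA : Fact (IsRieszMVAlgebra A)] :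
    AddCommMonoid A where
  add := oplus
  add_assoc := oplus_assoc
  zero := zero
  zero_add := zero_oplus
  add_zero := oplus_zero
  add_comm := oplus_comm
  nsmul := @nsmulRec A ⟨zero⟩ ⟨oplus⟩
  nsmul_zero _ := rfl
  nsmul_succ _ _ := rfl

attribute [local instance] addCommMonoid

theorem add_eq_oplus (x y : A) : x + y = x ⊕ₘ y := rfl

variable {ι : Type*} [Fintype ι]

/-- The linear combination of the `a i` with the coefficients `c i`. -/
noncomputable def comb (a : ι → A) (c : ι → ℝ) : A := ∑ i, scal (clip (c i)) (a i)

/-- Nonnegative coefficients with sum at most one. -/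
structure IsSubconvex (c : ι → ℝ) : Prop where
  nonneg : ∀ i, 0 ≤ c i
  sum_le : ∑ i, c i ≤ 1

theorem IsSubconvex.le_one {c : ι → ℝ} (h : IsSubconvex c) (i : ι) : c i ≤ 1 :=
  (Finset.single_le_sum (fun i _ => h.nonneg i) (Finset.mem_univ i)).trans h.sum_le

variable {a : ι → A}

theorem comb_add {c d : ι → ℝ} (hc : ∀ i, 0 ≤ c i) (hd : ∀ i, 0 ≤ d i) (h : ∀ i, c i + d i ≤ 1) :
    comb a (c + d) = comb a c ⊕ₘ comb a d := by
  rw [← add_eq_oplus, comb, comb, comb, ← Finset.sum_add_distrib]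
  refine Finset.sum_congr rfl fun i _ => add_scal ?_ _
  rw [Pi.add_apply, coe_clip (add_nonneg (hc i) (hd i)) (h i),
    coe_clip (hc i) (by linarith [hd i, h i]), coe_clip (hd i) (by linarith [hc i, h i])]

/-- A partial sum is bounded by a multiple of `1`, so the next summand is disjoint from it and
scalars distribute over the sum. -/
theorem sum_scal_le {c : ι → ℝ} (hc : IsSubconvex c) (s : Finset ι) :
    ∑ i ∈ s, scal (clip (c i)) (a i) ≤ scal (clip (∑ i ∈ s, c i)) one := by
  classical
  induction s using Finset.induction_on with
  | empty => exact zero_le _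
  | insert i s hi ih =>
    have h1 : 0 ≤ ∑ i ∈ s, c i := Finset.sum_nonneg fun i _ => hc.nonneg i
    have h2 : c i + ∑ i ∈ s, c i ≤ 1 := by
      rw [← Finset.sum_insert hi]
      exact (Finset.sum_le_univ_sum_of_nonneg hc.nonneg).trans hc.sum_le
    have h3 := hc.nonneg i
    rw [Finset.sum_insert hi, Finset.sum_insert hi, add_eq_oplus,
      add_scal (t := clip (c i + ∑ i ∈ s, c i)) (r := clip (c i)) (q := clip (∑ i ∈ s, c i))]
    · exact oplus_le_oplus (scal_le_scal _ (le_one _)) ih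
    · rw [coe_clip (add_nonneg h3 h1) h2, coe_clip h3 (by linarith), coe_clip h1 (by linarith)]

theorem sum_scal_smul (r : I) {c : ι → ℝ} (hc : IsSubconvex c) (s : Finset ι) :
    ∑ i ∈ s, scal (clip (r * c i)) (a i) = scal r (∑ i ∈ s, scal (clip (c i)) (a i)) := by
  classical
  induction s using Finset.induction_on with
  | empty => exact (scal_zero r).symm
  | insert i s hi ih =>
    have h1 : 0 ≤ ∑ i ∈ s, c i := Finset.sum_nonneg fun i _ => hc.nonneg i
    have h2 : c i + ∑ i ∈ s, c i ≤ 1 := by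
      rw [← Finset.sum_insert hi]
      exact (Finset.sum_le_univ_sum_of_nonneg hc.nonneg).trans hc.sum_le
    have h3 := hc.nonneg i
    rw [Finset.sum_insert hi, Finset.sum_insert hi, add_eq_oplus, add_eq_oplus, scal_oplus, ih,
      scal_scal]
    · congr 2
      apply Subtype.ext
      have hr := r.2
      rw [coe_clip (mul_nonneg hr.1 h3) (mul_le_one₀ hr.2 h3 (by linarith))]
      change _ = (r : ℝ) * _
      rw [        coe_clip h3 (by linarith)]
    · refine odot_eq_zero_of_le le_rfl (sum_scal_le hc s) (scal_odot_scal_eq_zero ?_ _ _)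
      rwa [coe_clip h3 (by linarith), coe_clip h1 (by linarith)]

theorem comb_smul (r : I) {c : ι → ℝ} (hc : IsSubconvex c) :
    comb a ((r : ℝ) • c) = scal r (comb a c) := sum_scal_smul r hc _

theorem comb_single [DecidableEq ι] (i : ι) (r : ℝ) :
    comb a (Pi.single i r) = scal (clip r) (a i) := by
  rw [comb, Finset.sum_eq_single i, Pi.single_eq_same]
  · intro j _ hj
    rw [Pi.single_eq_of_ne hj, clip_zero, zero_scal]; rfl
  · exact fun h => absurd (Finset.mem_univ i) h

theorem comb_zero : comb a (0 : ι → ℝ) = zero :=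
  Finset.sum_eq_zero fun i _ => by rw [Pi.zero_apply, clip_zero, zero_scal]; rfl

theorem isSubconvex_zero : IsSubconvex (0 : ι → ℝ) := ⟨fun _ => le_rfl, by simp⟩

theorem isSubconvex_single [DecidableEq ι] (i : ι) {r : ℝ} (h0 : 0 ≤ r) (h1 : r ≤ 1) :
    IsSubconvex (Pi.single i r : ι → ℝ) := by
  refine ⟨fun j => ?_, by simpa using h1⟩
  by_cases h : j = i
  · subst h; simpa using h0
  · simp [h]

variable (a) in
/-- `p` is, up to a positive factor, a difference of coefficient vectors whose combinations are
related by `R`. -/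
def Related (R : A → A → Prop) (p : ι → ℝ) : Prop :=
  ∃ l : ℝ, 0 < l ∧ ∃ c d : ι → ℝ, IsSubconvex c ∧ IsSubconvex d ∧ l • p = c - d ∧
    R (comb a d) (comb a c)

theorem Related.smul {R : A → A → Prop} {p : ι → ℝ} (h : Related a R p) {r : ℝ} (hr : 0 < r) :
    Related a R (r • p) := by
  obtain ⟨l, hl, c, d, hc, hd, e, h⟩ := h
  refine ⟨l / r, div_pos hl hr, c, d, hc, hd, ?_, h⟩
  rw [smul_smul, div_mul_cancel₀ _ hr.ne', e]

theorem comb_smul_add_smul {r q : I} (h : (r : ℝ) + q ≤ 1) {c d : ι → ℝ} (hc : IsSubconvex c)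
    (hd : IsSubconvex d) : IsSubconvex ((r : ℝ) • c + (q : ℝ) • d) ∧
      comb a ((r : ℝ) • c + (q : ℝ) • d) = scal r (comb a c) ⊕ₘ scal q (comb a d) := by
  have h1 (i) : 0 ≤ ((r : ℝ) • c) i := mul_nonneg r.2.1 (hc.nonneg i)
  have h2 (i) : 0 ≤ ((q : ℝ) • d) i := mul_nonneg q.2.1 (hd.nonneg i)
  have h3 : IsSubconvex ((r : ℝ) • c + (q : ℝ) • d) := by
    refine ⟨fun i => add_nonneg (h1 i) (h2 i), ?_⟩
    simp only [Pi.add_apply, Pi.smul_apply, smul_eq_mul]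
    rw [Finset.sum_add_distrib, ← Finset.mul_sum, ← Finset.mul_sum]
    have := mul_le_of_le_one_right r.2.1 hc.sum_le
    have := mul_le_of_le_one_right q.2.1 hd.sum_le
    linarith
  refine ⟨h3, ?_⟩
  rw [comb_add h1 h2 h3.le_one, comb_smul r hc, comb_smul q hd]

/-- `H` says how `R` and `S` combine into `T` under a subconvex combination of two comparisons, so
one rescaling argument serves for strict inequalities, equalities and their mixtures. -/
theorem Related.add {R S T : A → A → Prop}
    (H : ∀ r q : I, 0 < r → 0 < q → (r : ℝ) + q ≤ 1 → ∀ x y z w : A, R x y → S z w →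
      T (scal r x ⊕ₘ scal q z) (scal r y ⊕ₘ scal q w))
    {p p' : ι → ℝ} (h : Related a R p) (h' : Related a S p') : Related a T (p + p') := by
  obtain ⟨l, hl, c, d, hc, hd, e, h⟩ := h
  obtain ⟨m, hm, c', d', hc', hd', e', h'⟩ := h'
  -- The common factor is small enough for the weights `k / l` and `k / m` to be at most `1/2`,
  -- which keeps the combined vectors subconvex.
  set k := min l m / 2 with hk
  have hk0 : 0 < k := by positivity
  have hr : k / l ≤ 1 / 2 := by rw [div_le_iff₀ hl, hk]; linarith [min_le_left l m]
  have hq : k / m ≤ 1 / 2 := by rw [div_le_iff₀ hm, hk]; linarith [min_le_right l m]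
  have hr0 : 0 < k / l := by positivity
  have hq0 : 0 < k / m := by positivity
  let r : I := ⟨k / l, hr0.le, by linarith⟩
  let q : I := ⟨k / m, hq0.le, by linarith⟩
  have hrq : (r : ℝ) + q ≤ 1 := by change k / l + k / m ≤ 1; linarith
  obtain ⟨s1, e1⟩ := comb_smul_add_smul (a := a) hrq hc hc'
  obtain ⟨s2, e2⟩ := comb_smul_add_smul (a := a) hrq hd hd'
  refine ⟨k, hk0, _, _, s1, s2, ?_, ?_⟩
  · have : k • (p + p') = (k / l) • (l • p) + (k / m) • (m • p') := by
      rw [smul_smul, smul_smul, div_mul_cancel₀ _ hl.ne', div_mul_cancel₀ _ hm.ne', smul_add]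
    rw [this, e, e']
    change (k / l) • (c - d) + (k / m) • (c' - d') =
      (k / l) • c + (k / m) • c' - ((k / l) • d + (k / m) • d')
    module
  · rw [e1, e2]
    exact H r q hr0 hq0 hrq _ _ _ _ h h'

theorem Related.lt_add_lt {p q : ι → ℝ} (h : Related a (· < ·) p) (k : Related a (· < ·) q) :
    Related a (· < ·) (p + q) :=
  h.add (fun _ _ hr hq hrq _ _ _ _ h k => oplus_lt_oplus_of_lt_of_le (scal_lt_scal hr h)
    (scal_lt_scal hq k).le (scal_odot_scal_eq_zero hrq _ _)) k

theorem Related.lt_add_eq {p q : ι → ℝ} (h : Related a (· < ·) p) (k : Related a (· = ·) q) :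
    Related a (· < ·) (p + q) :=
  h.add (fun _ _ hr _ hrq _ _ _ _ h k => oplus_lt_oplus_of_lt_of_le (scal_lt_scal hr h)
    (k ▸ le_rfl) (scal_odot_scal_eq_zero hrq _ _)) k

theorem Related.eq_add_eq {p q : ι → ℝ} (h : Related a (· = ·) p) (k : Related a (· = ·) q) :
    Related a (· = ·) (p + q) :=
  h.add (fun _ _ _ _ _ _ _ _ _ h k => h ▸ k ▸ rfl) k

theorem Related.eq_neg {p : ι → ℝ} (h : Related a (· = ·) p) : Related a (· = ·) (-p) := by
  obtain ⟨l, hl, c, d, hc, hd, e, h⟩ := h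
  exact ⟨l, hl, d, c, hd, hc, by rw [smul_neg, e, neg_sub], h.symm⟩

theorem related_eq_zero : Related a (· = ·) (0 : ι → ℝ) :=
  ⟨1, one_pos, 0, 0, isSubconvex_zero, isSubconvex_zero, by simp, rfl⟩

theorem not_related_lt_zero : ¬ Related a (· < ·) (0 : ι → ℝ) := by
  rintro ⟨l, -, c, d, -, -, e, h⟩
  rw [smul_zero] at e
  rw [sub_eq_zero.1 e.symm] at h
  exact lt_irrefl _ h

variable (a) in
/-- The linear relations between the `a i`. -/
def relations : Submodule ℝ (ι → ℝ) where
  carrier := {p | Related a (· = ·) p}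
  add_mem' := Related.eq_add_eq
  zero_mem' := related_eq_zero
  smul_mem' r p hp := by
    rcases lt_trichotomy r 0 with h | rfl | h
    · have := (Related.smul hp (neg_pos.2 h)).eq_neg
      rwa [neg_smul, _root_.neg_neg] at this
    · simpa using related_eq_zero
    · exact Related.smul hp h

variable (a) in
/-- Finitely many strictly positive combinations are strictly positive for a linear functional
that respects all linear relations. -/
theorem exists_dual_pos {T : Set (ι → ℝ)} (hT : T.Finite) (h : ∀ p ∈ T, Related a (· < ·) p) :
    ∃ f : (ι → ℝ) →ₗ[ℝ] ℝ, (∀ p ∈ T, 0 < f p) ∧ ∀ p, Related a (· = ·) p → f p = 0 := by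
  have hconv : Convex ℝ {p | Related a (· < ·) p} := by
    intro p hp q hq r s hr hs hrs
    rcases hr.eq_or_lt with rfl | hr
    · rw [zero_add] at hrs; subst hrs; simpa using hq
    rcases hs.eq_or_lt with rfl | hs
    · rw [add_zero] at hrs; subst hrs; simpa using hp
    exact (Related.smul hp hr).lt_add_lt (Related.smul hq hs)
  -- The hull of `T` consists of strictly positive vectors. If one of them were also a linear
  -- relation `p`, adding `-p` would make the zero vector strictly positive.
  have hdisj : Disjoint (convexHull ℝ T) (relations a : Set (ι → ℝ)) := by
    rw [Set.disjoint_left]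
    intro p hp hp'
    have h1 : Related a (· < ·) p := convexHull_min h hconv hp
    have h2 : Related a (· = ·) p := hp'
    have := h1.lt_add_eq h2.eq_neg
    rw [add_neg_cancel] at this
    exact not_related_lt_zero this
  obtain ⟨f, u, v, hu, huv, hv⟩ := geometric_hahn_banach_compact_closed (convex_convexHull ℝ T)
    (hT.isCompact_convexHull ℝ) (relations a).convex
    (Submodule.closed_of_finiteDimensional _) hdisj
  -- `f` exceeds `v` on the whole subspace; if `f p ≠ 0`, the multiple `(v / f p) • p` would take
  -- exactly the value `v`.
  have hzero : ∀ p ∈ relations a, f p = 0 := by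
    intro p hp
    by_contra hne
    have := hv _ ((relations a).smul_mem (v / f p) hp)
    rw [map_smul, smul_eq_mul, div_mul_cancel₀ _ hne] at this
    exact lt_irrefl _ this
  have hv0 : v < 0 := by simpa using hv 0 (relations a).zero_mem
  -- On `T` the separating functional lies below `u < v < 0`, hence the change of sign.
  refine ⟨-f.toLinearMap, fun p hp => ?_, fun p hp => ?_⟩
  · have := hu p (subset_convexHull ℝ T hp)
    simp only [LinearMap.neg_apply, ContinuousLinearMap.coe_coe]
    linarith
  · simpa using hzero p hp

theorem related_single_sub_single [DecidableEq ι] {R : A → A → Prop} {i j : ι} (h : R (a i) (a j)) :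
    Related a R (Pi.single j 1 - Pi.single i 1) := by
  refine ⟨1, one_pos, _, _, isSubconvex_single j zero_le_one le_rfl,
    isSubconvex_single i zero_le_one le_rfl, one_smul _ _, ?_⟩
  have h1 : clip 1 = 1 := clip_coe 1
  rwa [comb_single, comb_single, h1, one_scal, one_scal]

theorem related_single [DecidableEq ι] {i : ι} (h : zero < a i) :
    Related a (· < ·) (Pi.single i 1) := by
  refine ⟨1, one_pos, _, _, isSubconvex_single i zero_le_one le_rfl,
    isSubconvex_zero, (one_smul _ _).trans (sub_zero _).symm, ?_⟩
  have h1 : clip 1 = 1 := clip_coe 1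
  rwa [comb_single, comb_zero, h1, one_scal]

theorem related_oplus [DecidableEq ι] {i j k : ι} (h : a i ⊙ₘ a j = zero)
    (hk : a k = a i ⊕ₘ a j) :
    Related a (· = ·) (Pi.single k 1 - (Pi.single i 1 + Pi.single j 1)) := by
  have h0 : ((clip (1 / 2) : I) : ℝ) = 1 / 2 := coe_clip (by norm_num) (by norm_num)
  obtain ⟨s, e⟩ := comb_smul_add_smul (a := a) (r := clip (1 / 2)) (q := clip (1 / 2))
    (by rw [h0]; norm_num) (isSubconvex_single i zero_le_one le_rfl)
    (isSubconvex_single j zero_le_one le_rfl)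
  have h1 : clip 1 = 1 := clip_coe 1
  -- The vector `δ i + δ j` has coefficient sum `2`, so the relation is stated for its half.
  refine ⟨1 / 2, by norm_num, _, _, isSubconvex_single k (r := 1 / 2) (by norm_num) (by norm_num),
    s, ?_, ?_⟩
  · rw [h0, smul_sub, smul_add, ← Pi.single_smul, smul_eq_mul, mul_one]
  · rw [e, comb_single, comb_single, comb_single, h1, one_scal, one_scal, hk, scal_oplus _ h]

theorem related_scal [DecidableEq ι] {i k : ι} {r : I} (hk : a k = scal r (a i)) :
    Related a (· = ·) (Pi.single k 1 - Pi.single i (r : ℝ)) := by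
  refine ⟨1, one_pos, _, _, isSubconvex_single k zero_le_one le_rfl,
    isSubconvex_single i r.2.1 r.2.2, one_smul _ _, ?_⟩
  have h1 : clip 1 = 1 := clip_coe 1
  rw [comb_single, comb_single, h1, one_scal, clip_coe, hk]

/-- On a finite subset of a Riesz MV-algebra there is a monotone real function which respects all
disjoint sums and scalar multiples in the subset, and separates a given element from `1`. -/
theorem exists_functional (s : Finset A) {z : A} (h1 : one ∈ s) (hz : z ∈ s) (hz1 : z ≠ one) :
    ∃ g : A → ℝ, g one = 1 ∧ g z < 1 ∧ (∀ x ∈ s, ∀ y ∈ s, x ≤ y → g x ≤ g y) ∧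
      (∀ x ∈ s, ∀ y ∈ s, x ⊙ₘ y = zero → x ⊕ₘ y ∈ s → g (x ⊕ₘ y) = g x + g y) ∧
      ∀ (r : I), ∀ x ∈ s, scal r x ∈ s → g (scal r x) = r * g x := by
  classical
  let a : s → A := Subtype.val
  let δ : s → s → ℝ := fun i => Pi.single i 1
  have h01 : (zero : A) < one := by
    refine lt_of_le_of_ne (zero_le _) fun h => hz1 (le_antisymm (le_one z) ?_)
    rw [← h]; exact zero_le z
  -- Positivity is required at `1`, to allow normalization, and on every strict inequality within
  -- `s`; the one between `z` and `1` yields the separation.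
  obtain ⟨f, hpos, hnull⟩ := exists_dual_pos a
    (T := insert (δ ⟨one, h1⟩) ((fun x : s × s => δ x.2 - δ x.1) '' {x | a x.1 < a x.2}))
    (Set.toFinite _) (by
      rintro p (rfl | ⟨⟨i, j⟩, hij, rfl⟩)
      · exact related_single h01
      · exact related_single_sub_single hij)
  set c := f (δ ⟨one, h1⟩) with hc
  have hc0 : 0 < c := hpos _ (Set.mem_insert _ _)
  have hlt : ∀ i j : s, a i < a j → f (δ i) < f (δ j) := by
    intro i j hij
    have := hpos _ (Set.mem_insert_of_mem _ ⟨(i, j), hij, rfl⟩)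
    rwa [map_sub, sub_pos] at this
  -- Division by `f (δ 1)` normalizes the value at `1`. The value `0` outside `s` plays no role,
  -- since every condition concerns elements of `s` only.
  refine ⟨fun x => if h : x ∈ s then f (δ ⟨x, h⟩) / c else 0, ?_, ?_, ?_, ?_, ?_⟩
  · dsimp only
    rw [dif_pos h1, div_self hc0.ne']
  · dsimp only
    rw [dif_pos hz, div_lt_one hc0]
    exact hlt _ _ (lt_of_le_of_ne (le_one z) hz1)
  · intro x hx y hy hxy
    dsimp only
    rw [dif_pos hx, dif_pos hy]
    rcases hxy.eq_or_lt with rfl | hxy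
    · exact le_rfl
    · exact div_le_div_of_nonneg_right (hlt ⟨x, hx⟩ ⟨y, hy⟩ hxy).le hc0.le
  · intro x hx y hy hxy hs
    dsimp only
    rw [dif_pos hx, dif_pos hy, dif_pos hs, ← add_div]
    have := hnull _ (related_oplus (a := a) (i := ⟨x, hx⟩) (j := ⟨y, hy⟩) (k := ⟨_, hs⟩) hxy rfl)
    rw [map_sub, map_add, sub_eq_zero] at this
    rw [this]
  · intro r x hx hs
    dsimp only
    rw [dif_pos hx, dif_pos hs, ← mul_div_assoc]
    have := hnull _ (related_scal (a := a) (i := ⟨x, hx⟩) (k := ⟨_, hs⟩) (r := r) rfl)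
    have e : (Pi.single ⟨x, hx⟩ (r : ℝ) : s → ℝ) = (r : ℝ) • δ ⟨x, hx⟩ := by
      rw [← Pi.single_smul, smul_eq_mul, mul_one]
    rw [map_sub, sub_eq_zero, e, map_smul, smul_eq_mul] at this
    rw [this]

end MV

end Functional

/-! ### The Lindenbaum-Tarski algebra and completeness of the logic -/

namespace Formula.Provable

variable {V : Type*} {φ ψ χ : Formula V}

theorem exch_imp (φ ψ χ : Formula V) : Provable (imp (imp φ (imp ψ χ)) (imp ψ (imp φ χ))) :=
  trans (l2 φ (imp ψ χ) χ) (mp (exch (id (imp ψ χ))) (l2 ψ (imp (imp ψ χ) χ) (imp φ χ)))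

theorem imp_not_not (φ ψ : Formula V) : Provable (imp (imp φ ψ) (imp (not ψ) (not φ))) :=
  trans (imp_congr (not_not_elim φ) (not_not_intro ψ)) (l4 _ _)

theorem true_imp (h : Provable φ) : Provable (imp (imp φ ψ) ψ) :=
  mp h (exch (id _))

end Formula.Provable

namespace RL

open Formula Formula.Provable

variable {n : ℕ}

theorem mk_eq_mk {φ ψ : Formula (Fin n)} :
    mk φ = mk ψ ↔ Provable (.imp φ ψ) ∧ Provable (.imp ψ φ) := Quotient.eq

theorem ind {p : RL n → Prop} (h : ∀ φ, p (mk φ)) (a : RL n) : p a := Quotient.ind h a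

/-- The implication of `RL n`. -/
def imp : RL n → RL n → RL n :=
  Quotient.map₂ .imp fun _ _ h _ _ k => ⟨h.2.imp_congr k.1, h.1.imp_congr k.2⟩

/-- The operation `∇_r` of `RL n`. -/
def nabla (r : I) : RL n → RL n :=
  Quotient.map (.nabla r) fun _ _ h => ⟨h.1.nabla_congr r, h.2.nabla_congr r⟩

theorem mk_imp (φ ψ : Formula (Fin n)) : mk (.imp φ ψ) = imp (mk φ) (mk ψ) := rfl

theorem mk_nabla (r : I) (φ : Formula (Fin n)) : mk (.nabla r φ) = nabla r (mk φ) := rfl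

theorem imp_left_comm (a b c : RL n) : imp a (imp b c) = imp b (imp a c) := by
  induction a using ind; induction b using ind; induction c using ind
  exact mk_eq_mk.2 ⟨exch_imp _ _ _, exch_imp _ _ _⟩

theorem imp_imp_self (a b : RL n) : imp (imp a b) b = imp (imp b a) a := by
  induction a using ind; induction b using ind
  exact mk_eq_mk.2 ⟨l3 _ _, l3 _ _⟩

theorem nabla_imp (r : I) (a b : RL n) : nabla r (imp a b) = imp (nabla r a) (nabla r b) := by
  induction a using ind; induction b using ind
  exact mk_eq_mk.2 ⟨(r1 _ _ _).iff_left, (r1 _ _ _).iff_right⟩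

theorem nabla_odot_neg (r q : I) (a : RL n) :
    nabla (odot r (neg q)) a = imp (nabla q a) (nabla r a) := by
  induction a using ind
  exact mk_eq_mk.2 ⟨(r2 _ _ _).iff_left, (r2 _ _ _).iff_right⟩

theorem nabla_nabla (r q : I) (a : RL n) : nabla r (nabla q a) = nabla (r * q) a := by
  induction a using ind
  exact mk_eq_mk.2 ⟨(r3 _ _ _).iff_left, (r3 _ _ _).iff_right⟩

theorem one_nabla (a : RL n) : nabla 1 a = a := by
  induction a using ind
  exact mk_eq_mk.2 ⟨(r4 _).iff_left, (r4 _).iff_right⟩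

variable [NeZero n]

theorem mk_not (φ : Formula (Fin n)) : mk (.not φ) = neg (mk φ) := rfl

theorem oplus_def (a b : RL n) : oplus a b = imp (neg a) b := by
  induction a using ind; induction b using ind; rfl

theorem scal_def (r : I) (a : RL n) : scal r a = neg (nabla r (neg a)) := by
  induction a using ind; rfl

theorem neg_neg (a : RL n) : neg (neg a) = a := by
  induction a using ind
  exact mk_eq_mk.2 ⟨not_not_elim _, not_not_intro _⟩

theorem imp_neg_neg (a b : RL n) : imp (neg a) (neg b) = imp b a := by
  induction a using ind; induction b using ind
  exact mk_eq_mk.2 ⟨l4 _ _, imp_not_not _ _⟩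

theorem mk_eq_one {φ : Formula (Fin n)} : mk φ = one ↔ Provable φ := by
  have h0 : (one : RL n) = mk (.imp (.var 0) (.var 0)) := neg_neg (mk _)
  rw [h0, mk_eq_mk]
  exact ⟨fun h => mp (Provable.id _) h.2,
    fun h => ⟨mp (Provable.id _) (l1 _ _), mp h (l1 _ _)⟩⟩

theorem one_imp (a : RL n) : imp one a = a := by
  induction a using ind with | _ φ
  have h0 : (one : RL n) = mk (.imp (.var 0) (.var 0)) := neg_neg (mk _)
  rw [h0]
  exact mk_eq_mk.2 ⟨true_imp (Provable.id _), l1 _ _⟩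

theorem zero_imp (a : RL n) : imp zero a = one := by
  induction a using ind with | _ φ
  exact mk_eq_one.2 (mp (mp (Provable.id _) (not_not_intro _)) (exfalso _ _))

theorem neg_imp_comm (a b : RL n) : imp (neg a) b = imp (neg b) a := by
  rw [← imp_neg_neg, neg_neg]

theorem odot_neg (a b : RL n) : odot a (neg b) = neg (imp a b) := by
  rw [odot, oplus_def, neg_neg, neg_neg]

theorem isRieszMVAlgebra : IsRieszMVAlgebra (RL n) where
  oplus_assoc x y z := by
    simp only [oplus_def]
    rw [neg_imp_comm, imp_left_comm, neg_imp_comm z y]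
  oplus_comm x y := by rw [oplus_def, oplus_def, neg_imp_comm]
  oplus_zero x := by rw [oplus_def, neg_imp_comm, ← one, one_imp]
  neg_neg := neg_neg
  lukasiewicz x y := by simp only [oplus_def, neg_neg, imp_imp_self x y]
  neg_zero_oplus x := by rw [oplus_def, neg_neg, zero_imp, one]
  scal_odot r x y := by
    rw [odot_neg, odot_neg, scal_def, scal_def, scal_def, imp_neg_neg, neg_neg, ← nabla_imp,
      imp_neg_neg]
  scal_odot_scalar r q x := by
    rw [odot_neg, scal_def, scal_def, scal_def, imp_neg_neg, nabla_odot_neg]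
  scal_scal r q x := by rw [scal_def, scal_def, scal_def, neg_neg, nabla_nabla]
  one_scal x := by rw [scal_def, one_nabla, neg_neg]

theorem mk_imp_eq_impl (φ ψ : Formula (Fin n)) : mk (.imp φ ψ) = impl (mk φ) (mk ψ) := by
  rw [impl, oplus_def, neg_neg, mk_imp]

theorem mk_nabla_eq (r : I) (φ : Formula (Fin n)) :
    mk (.nabla r φ) = neg (scal r (neg (mk φ))) := by
  rw [scal_def, neg_neg, neg_neg, mk_nabla]

end RL

theorem coe_oplus (x y : I) : ((oplus x y : I) : ℝ) = min 1 ((x : ℝ) + y) := rfl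

theorem coe_neg (x : I) : ((neg x : I) : ℝ) = 1 - x := rfl

theorem coe_zero : ((zero : I) : ℝ) = 0 := rfl

theorem coe_scal (r x : I) : ((scal r x : I) : ℝ) = r * x := rfl

theorem coe_impl (x y : I) : ((impl x y : I) : ℝ) = min 1 (1 - (x : ℝ) + y) := rfl

/-! ### Transfer of a failing formula from a chain to `[0,1]`. -/

section Valuation

open Formula MV

attribute [local instance] partialOrder

variable {V L : Type*} [RieszMVOps L] [hL : Fact (IsRieszMVAlgebra L)]

open scoped Classical in
/-- The finitely many elements which occur in the computation of the value of a formula. -/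
noncomputable def valueSet (v : Formula V → L) : Formula V → Finset L
  | .var i => {v (.var i)}
  | .not φ => valueSet v φ ∪ {v φ, neg (v φ)}
  | .imp φ ψ => valueSet v φ ∪ valueSet v ψ ∪ {v φ, v ψ, neg (v φ), impl (v φ) (v ψ)}
  | .nabla r φ => valueSet v φ ∪
      {v φ, neg (v φ), scal r (neg (v φ)), neg (scal r (neg (v φ)))}

/-- A formula which fails in a totally ordered Riesz MV-algebra fails in `[0,1]`. -/
theorem exists_eval_ne_one (hchain : ∀ x y : L, impl x y = one ∨ impl y x = one)
    {v : Formula V → L} (hnot : ∀ φ, v (.not φ) = neg (v φ))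
    (himp : ∀ φ ψ, v (.imp φ ψ) = impl (v φ) (v ψ))
    (hnabla : ∀ r φ, v (.nabla r φ) = neg (scal r (neg (v φ)))) {φ : Formula V} (hφ : v φ ≠ one) :
    ∃ x : V → I, φ.eval x ≠ 1 := by
  classical
  let s : Finset L := insert zero (insert one (insert (v φ) (valueSet v φ)))
  have h0 : zero ∈ s := by simp [s]
  have h1 : one ∈ s := by simp [s]
  obtain ⟨g, g1, gφ, gmono, gadd, gscal⟩ := exists_functional s h1
    (show v φ ∈ s by simp [s]) hφ
  have g0 : g zero = 0 := by
    have := gscal 0 zero h0 (by rwa [zero_scal])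
    rwa [zero_scal, Set.Icc.coe_zero, zero_mul] at this
  -- `x` and `∼x` are disjoint with sum `1`, so additivity applies.
  have gneg : ∀ x ∈ s, neg x ∈ s → g (neg x) = 1 - g x := by
    intro x hx hx'
    have := gadd x hx _ hx' (odot_neg_self x) (by rwa [oplus_neg_self])
    rw [oplus_neg_self, g1] at this
    linarith
  have gI : ∀ x ∈ s, g x ∈ Set.Icc (0 : ℝ) 1 := fun x hx =>
    ⟨g0 ▸ gmono _ h0 _ hx (zero_le x), g1 ▸ gmono _ hx _ h1 (le_one x)⟩
  let x : V → I := fun i => clip (g (v (.var i)))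
  have key : ∀ ψ : Formula V, valueSet v ψ ⊆ s → (ψ.eval x : ℝ) = g (v ψ) := by
    intro ψ
    induction ψ with
    | var i =>
      intro h
      have := gI _ (h (Finset.mem_singleton_self _))
      exact coe_clip this.1 this.2
    | not ψ ih =>
      intro h
      simp only [valueSet, Finset.union_subset_iff, Finset.insert_subset_iff,
        Finset.singleton_subset_iff] at h
      rw [eval, coe_neg, ih h.1, hnot, gneg _ h.2.1 h.2.2]
    | imp ψ χ ih1 ih2 =>
      intro h
      simp only [valueSet, Finset.union_subset_iff, Finset.insert_subset_iff,
        Finset.singleton_subset_iff] at h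
      obtain ⟨⟨hψ, hχ⟩, k1, k2, k3, k4⟩ := h
      rw [eval, coe_impl, ih1 hψ, ih2 hχ, himp]
      -- Total order enters here: either the implication is `1`, or `v χ ≤ v ψ` and `∼(v ψ) ⊕ v χ`
      -- is a disjoint sum, on which `g` is additive.
      rcases hchain (v ψ) (v χ) with h | h
      · rw [h, g1, min_eq_left]
        have := gmono _ k1 _ k2 h
        linarith
      · have := gmono _ k2 _ k1 h
        have hd : odot (neg (v ψ)) (v χ) = zero := by
          rw [odot_comm, odot_neg_eq_zero]; exact h
        rw [impl, gadd _ k3 _ k2 hd k4, gneg _ k1 k3, min_eq_right]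
        linarith
    | nabla r ψ ih =>
      intro h
      simp only [valueSet, Finset.union_subset_iff, Finset.insert_subset_iff,
        Finset.singleton_subset_iff] at h
      obtain ⟨hψ, k1, k2, k3, k4⟩ := h
      rw [eval, coe_neg, coe_scal, coe_neg, ih hψ, hnabla, gneg _ k3 k4, gscal _ _ k2 k3,
        gneg _ k1 k2]
  refine ⟨x, fun h => ?_⟩
  have := key φ (fun y hy => by simp [s, hy])
  rw [h] at this
  exact gφ.ne this.symm

end Valuation

namespace RL

open Formula

variable {n : ℕ} [NeZero n]

/-- Completeness of the logic with respect to `[0,1]`. -/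
theorem mk_eq_one_of_eval {φ : Formula (Fin n)} (h : ∀ x, φ.eval x = 1) : mk φ = one := by
  by_contra hφ
  have : Fact (IsRieszMVAlgebra (RL n)) := ⟨isRieszMVAlgebra⟩
  obtain ⟨L, _, π, hL, hπ, hchain, hne⟩ := MV.exists_chain_quotient hφ
  have : Fact (IsRieszMVAlgebra L) := ⟨hL⟩
  obtain ⟨x, hx⟩ := exists_eval_ne_one hchain (v := fun φ => π (mk φ))
    (fun φ => by rw [mk_not, hπ.map_neg])
    (fun φ ψ => by rw [mk_imp_eq_impl, hπ.map_impl])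
    (fun r φ => by rw [mk_nabla_eq, hπ.map_neg, hπ.map_scal, hπ.map_neg]) hne
  exact hx (h x)

theorem mk_eq_mk_iff_eval {φ ψ : Formula (Fin n)} :
    mk φ = mk ψ ↔ ∀ x, φ.eval x = ψ.eval x := by
  refine ⟨fun h => Provable.eval_eq (mk_eq_mk.1 h).1 (mk_eq_mk.1 h).2, fun h => mk_eq_mk.2 ?_⟩
  constructor
  · exact mk_eq_one.1 (mk_eq_one_of_eval fun x => Provable.impl_eq_one.2 (h x).le)
  · exact mk_eq_one.1 (mk_eq_one_of_eval fun x => Provable.impl_eq_one.2 (h x).ge)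

end RL

/-! ### The algebra `L1u n` -/

theorem coe_odot (x y : I) : ((odot x y : I) : ℝ) = max 0 ((x : ℝ) + y - 1) := by
  change 1 - min 1 (1 - (x : ℝ) + (1 - y)) = _
  grind

theorem coe_one : ((one : I) : ℝ) = 1 := sub_zero _

theorem isRieszMVAlgebra_unitInterval : IsRieszMVAlgebra I where
  oplus_assoc x y z := by
    apply Subtype.ext
    simp only [coe_oplus]
    have := x.2.1; have := y.2.1; have := z.2.1
    grind
  oplus_comm x y := Subtype.ext (by rw [coe_oplus, coe_oplus, add_comm])
  oplus_zero x := Subtype.ext (by rw [coe_oplus, coe_zero, add_zero, min_eq_right x.2.2])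
  neg_neg x := Subtype.ext (by rw [coe_neg, coe_neg, sub_sub_cancel])
  lukasiewicz x y := by
    apply Subtype.ext
    simp only [coe_oplus, coe_neg]
    have := x.2.2; have := y.2.2
    grind
  neg_zero_oplus x := by
    apply Subtype.ext
    rw [coe_oplus, coe_neg, coe_zero]
    have := x.2.1
    grind
  scal_odot r x y := by
    apply Subtype.ext
    simp only [coe_odot, coe_neg, coe_scal]
    rw [mul_max_of_nonneg _ _ r.2.1]
    congr 1 <;> ring
  scal_odot_scalar r q x := by
    apply Subtype.ext
    simp only [coe_odot, coe_neg, coe_scal]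
    rw [max_mul_of_nonneg _ _ x.2.1]
    congr 1 <;> ring
  scal_scal r q x := Subtype.ext (mul_assoc (r : ℝ) q x).symm
  one_scal x := Subtype.ext (one_mul (x : ℝ))

theorem coe_symmDiff (x y : I) :
    ((oplus (odot x (neg y)) (odot (neg x) y) : I) : ℝ) = |(x : ℝ) - y| := by
  simp only [coe_oplus, coe_odot, coe_neg]
  have := x.2; have := y.2
  simp only [Set.mem_Icc] at *
  grind

theorem coe_add_of_odot_eq_zero {x y : I} (h : odot x y = zero) :
    ((oplus x y : I) : ℝ) = x + y := by
  have := congrArg Subtype.val h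
  rw [coe_odot, coe_zero, max_eq_left_iff] at this
  rw [coe_oplus, min_eq_right (by linarith)]

/-- Since `(0,1)` is dense in `[0,1]`, a nonempty relatively open set contains a nonempty open set
of the line. It ensures that continuous functions on the cube which agree almost everywhere are
equal. -/
instance : Measure.IsOpenPosMeasure (volume : Measure I) where
  open_pos := by
    rintro s hs ⟨x, hx⟩ h
    obtain ⟨U, hU, rfl⟩ := isOpen_induced_iff.1 hs
    have hcl : (x : ℝ) ∈ closure (Set.Ioo (0 : ℝ) 1) := by
      rw [closure_Ioo zero_ne_one]; exact x.2
    have hne : (U ∩ Set.Ioo 0 1).Nonempty := mem_closure_iff.1 hcl U hU hx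
    have := (hU.inter isOpen_Ioo).measure_pos volume hne
    rw [volume_apply] at h
    refine this.ne' (measure_mono_null ?_ h)
    rintro y ⟨hy, hy'⟩
    exact ⟨⟨y, hy'.1.le, hy'.2.le⟩, hy, rfl⟩

theorem integrable_coe {X : Type*} [MeasurableSpace X] {μ : Measure X} [IsFiniteMeasure μ]
    {f : X → I} (hf : AEStronglyMeasurable (fun x => (f x : ℝ)) μ) :
    Integrable (fun x => (f x : ℝ)) μ :=
  Integrable.of_bound hf 1 (Filter.Eventually.of_forall fun x => by
    rw [Real.norm_of_nonneg (f x).2.1]; exact (f x).2.2)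

namespace L1u

open MV

variable {n : ℕ}

/-- The representative of an element of `L1u n` with all values in `[0,1]`. -/
noncomputable def rep (f : L1u n) (x : Fin n → I) : I := clip (f.1 x)

theorem coe_rep (f : L1u n) : (fun x => (rep f x : ℝ)) =ᵐ[volume] f.1 := by
  filter_upwards [f.2] with x hx
  exact coe_clip hx.1 hx.2

theorem integrable_rep (f : L1u n) : Integrable (fun x => (rep f x : ℝ)) :=
  (L1.integrable_coeFn f.1).congr (coe_rep f).symm

theorem rep_ae_eq {f : L1u n} {g : (Fin n → I) → I}
    (h : f.1 =ᵐ[volume] fun x => (g x : ℝ)) : rep f =ᵐ[volume] g := by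
  filter_upwards [h, coe_rep f] with x h1 h2
  exact Subtype.ext (h2.trans h1)

/-- Through this the laws of `L1u n` reduce to those of `[0,1]`, checked at almost every point. -/
theorem ext_rep {f g : L1u n} (h : rep f =ᵐ[volume] rep g) : f = g := by
  apply Subtype.ext
  apply Lp.ext
  filter_upwards [h, coe_rep f, coe_rep g] with x h1 h2 h3
  rw [← h2, ← h3, h1]

theorem rep_oplus (f g : L1u n) :
    rep (oplus f g) =ᵐ[volume] fun x => oplus (rep f x) (rep g x) := by
  apply rep_ae_eq
  filter_upwards [coe_rep f, coe_rep g, Lp.coeFn_inf (Lp.const 1 volume (1 : ℝ)) (f.1 + g.1),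
      Lp.coeFn_add f.1 g.1, Lp.coeFn_const (p := 1) (μ := (volume : Measure (Fin n → I))) (1 : ℝ)]
      with x hf hg h1 h2 h3
  rw [coe_oplus, hf, hg]
  change (Lp.const 1 volume (1 : ℝ) ⊓ (f.1 + g.1) : Lp ℝ 1 volume) x = _
  rw [h1, Pi.inf_apply, h2, h3, Pi.add_apply]
  rfl

theorem rep_neg (f : L1u n) : rep (neg f) =ᵐ[volume] fun x => neg (rep f x) := by
  apply rep_ae_eq
  filter_upwards [coe_rep f, Lp.coeFn_sub (Lp.const 1 volume (1 : ℝ)) f.1,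
      Lp.coeFn_const (p := 1) (μ := (volume : Measure (Fin n → I))) (1 : ℝ)] with x hf h1 h2
  rw [coe_neg, hf]
  change (Lp.const 1 volume (1 : ℝ) - f.1 : Lp ℝ 1 volume) x = _
  rw [h1, Pi.sub_apply, h2]
  rfl

theorem rep_zero : rep (zero : L1u n) =ᵐ[volume] fun _ => zero := by
  apply rep_ae_eq
  filter_upwards [Lp.coeFn_zero ℝ 1 (volume : Measure (Fin n → I))] with x h
  exact h

theorem rep_scal (r : I) (f : L1u n) :
    rep (scal r f) =ᵐ[volume] fun x => scal r (rep f x) := by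
  apply rep_ae_eq
  filter_upwards [coe_rep f, Lp.coeFn_smul (r : ℝ) f.1] with x hf h
  rw [coe_scal, hf]
  exact h

theorem rep_one : rep (one : L1u n) =ᵐ[volume] fun _ => one := by
  filter_upwards [rep_neg (zero : L1u n), rep_zero (n := n)] with x h1 h2
  rw [one, h1, h2, one]

theorem rep_odot (f g : L1u n) :
    rep (odot f g) =ᵐ[volume] fun x => odot (rep f x) (rep g x) := by
  filter_upwards [rep_neg (oplus (neg f) (neg g)), rep_oplus (neg f) (neg g), rep_neg f, rep_neg g]
    with x h1 h2 h3 h4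
  rw [odot, h1, h2, h3, h4, odot]

theorem isRieszMVAlgebra : IsRieszMVAlgebra (L1u n) where
  oplus_assoc f g h := by
    apply ext_rep
    filter_upwards [rep_oplus (oplus f g) h, rep_oplus f g, rep_oplus f (oplus g h),
      rep_oplus g h] with x h1 h2 h3 h4
    rw [h1, h2, h3, h4, isRieszMVAlgebra_unitInterval.oplus_assoc]
  oplus_comm f g := by
    apply ext_rep
    filter_upwards [rep_oplus f g, rep_oplus g f] with x h1 h2
    rw [h1, h2, isRieszMVAlgebra_unitInterval.oplus_comm]
  oplus_zero f := by
    apply ext_rep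
    filter_upwards [rep_oplus f zero, rep_zero (n := n)] with x h1 h2
    rw [h1, h2, isRieszMVAlgebra_unitInterval.oplus_zero]
  neg_neg f := by
    apply ext_rep
    filter_upwards [rep_neg (neg f), rep_neg f] with x h1 h2
    rw [h1, h2, isRieszMVAlgebra_unitInterval.neg_neg]
  lukasiewicz f g := by
    apply ext_rep
    filter_upwards [rep_oplus (neg (oplus (neg f) g)) g, rep_neg (oplus (neg f) g),
      rep_oplus (neg f) g, rep_neg f, rep_oplus (neg (oplus (neg g) f)) f,
      rep_neg (oplus (neg g) f), rep_oplus (neg g) f, rep_neg g] with x h1 h2 h3 h4 k1 k2 k3 k4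
    rw [h1, h2, h3, h4, k1, k2, k3, k4, isRieszMVAlgebra_unitInterval.lukasiewicz]
  neg_zero_oplus f := by
    apply ext_rep
    filter_upwards [rep_oplus (neg zero) f, rep_neg (zero : L1u n), rep_zero (n := n)]
      with x h1 h2 h3
    rw [h1, h2, h3, isRieszMVAlgebra_unitInterval.neg_zero_oplus]
  scal_odot r f g := by
    apply ext_rep
    filter_upwards [rep_scal r (odot f (neg g)), rep_odot f (neg g), rep_neg g,
      rep_odot (scal r f) (neg (scal r g)), rep_neg (scal r g), rep_scal r f, rep_scal r g]
      with x h1 h2 h3 h4 h5 h6 h7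
    rw [h1, h2, h3, h4, h5, h6, h7, isRieszMVAlgebra_unitInterval.scal_odot]
  scal_odot_scalar r q f := by
    apply ext_rep
    filter_upwards [rep_scal (odot r (neg q)) f, rep_odot (scal r f) (neg (scal q f)),
      rep_neg (scal q f), rep_scal r f, rep_scal q f] with x h1 h2 h3 h4 h5
    rw [h1, h2, h3, h4, h5, isRieszMVAlgebra_unitInterval.scal_odot_scalar]
  scal_scal r q f := by
    apply ext_rep
    filter_upwards [rep_scal r (scal q f), rep_scal q f, rep_scal (r * q) f] with x h1 h2 h3
    rw [h1, h2, h3, isRieszMVAlgebra_unitInterval.scal_scal]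
  one_scal f := by
    apply ext_rep
    filter_upwards [rep_scal 1 f] with x h1
    rw [h1, isRieszMVAlgebra_unitInterval.one_scal]

theorem integral_eq (f : L1u n) : integral n f = ∫ x, (rep f x : ℝ) :=
  integral_congr_ae (coe_rep f).symm

theorem isState_integral : IsState (integral n) where
  mem_Icc f := by
    rw [integral_eq]
    refine ⟨integral_nonneg fun x => (rep f x).2.1, ?_⟩
    refine (integral_mono (integrable_rep f) (integrable_const 1) fun x => (rep f x).2.2).trans ?_
    simp
  map_one := by
    have : (fun x => (rep (one : L1u n) x : ℝ)) =ᵐ[volume] fun _ => 1 := by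
      filter_upwards [rep_one (n := n)] with x h
      rw [h, coe_one]
    rw [integral_eq, integral_congr_ae this]
    simp
  map_oplus f g h := by
    rw [integral_eq, integral_eq, integral_eq, ← integral_add (integrable_rep f) (integrable_rep g)]
    apply integral_congr_ae
    filter_upwards [rep_oplus f g, rep_odot f g, rep_zero (n := n)] with x h1 h2 h3
    rw [h, h3] at h2
    rw [h1, coe_add_of_odot_eq_zero h2.symm]

theorem isNormed_integral : IsNormed (integral n) where
  isRieszMVAlgebra := isRieszMVAlgebra
  isState := isState_integral
  faithful f h := by
    rw [integral_eq, integral_eq_zero_iff_of_nonneg (fun x => (rep f x).2.1)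
      (integrable_rep f)] at h
    apply ext_rep
    filter_upwards [h, rep_zero (n := n)] with x h1 h2
    rw [h2]
    exact Subtype.ext h1

/-- In `[0,1]` the expression `(x ⊙ y*) ⊕ (x* ⊙ y)` equals `|x - y|`, so integrating it gives the
`L^1` distance. -/
theorem dist_eq_rho (f g : L1u n) : dist f.1 g.1 = rho (integral n) f g := by
  rw [rho, integral_eq, dist_eq_norm, L1.norm_eq_integral_norm]
  apply integral_congr_ae
  filter_upwards [Lp.coeFn_sub f.1 g.1, coe_rep f, coe_rep g,
    rep_oplus (odot f (neg g)) (odot (neg f) g), rep_odot f (neg g), rep_odot (neg f) g,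
    rep_neg f, rep_neg g] with x h h1 h2 h3 h4 h5 h6 h7
  rw [h3, h4, h5, h6, h7, coe_symmDiff, h1, h2, h, Pi.sub_apply, Real.norm_eq_abs]

/-- The metric of `L1u n` as a subspace of `L^1`. -/
@[reducible]
noncomputable def metricSpace (n : ℕ) : MetricSpace (L1u n) :=
  inferInstanceAs (MetricSpace {f : Lp ℝ 1 (volume : Measure (Fin n → I)) //
    ∀ᵐ x, f x ∈ Set.Icc (0 : ℝ) 1})

theorem isStateComplete_integral : IsStateComplete (integral n) := by
  refine ⟨metricSpace n, dist_eq_rho, ?_⟩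
  -- The carrier is an order interval of a Banach lattice, hence closed and therefore complete.
  have h : {f : Lp ℝ 1 (volume : Measure (Fin n → I)) | ∀ᵐ x, f x ∈ Set.Icc (0 : ℝ) 1} =
      Set.Icc 0 (Lp.const 1 volume (1 : ℝ)) := by
    ext f
    rw [Set.mem_Icc, ← Lp.coeFn_le, ← Lp.coeFn_le]
    constructor
    · intro hf
      constructor
      · filter_upwards [hf, Lp.coeFn_zero ℝ 1 (volume : Measure (Fin n → I))] with x h1 h2
        rw [h2]; exact h1.1
      · filter_upwards [hf, Lp.coeFn_const (p := 1) (μ := (volume : Measure (Fin n → I))) (1 : ℝ)]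
          with x h1 h2
        rw [h2]; exact h1.2
    · rintro ⟨h1, h2⟩
      filter_upwards [h1, h2, Lp.coeFn_zero ℝ 1 (volume : Measure (Fin n → I)),
        Lp.coeFn_const (p := 1) (μ := (volume : Measure (Fin n → I))) (1 : ℝ)] with x h1 h2 h3 h4
      rw [h3] at h1
      rw [h4] at h2
      exact ⟨h1, h2⟩
  have hclosed : IsClosed {f : Lp ℝ 1 (volume : Measure (Fin n → I)) |
      ∀ᵐ x, f x ∈ Set.Icc (0 : ℝ) 1} := h ▸ isClosed_Icc
  exact hclosed.completeSpace_coe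

end L1u

/-! ### Uniqueness of norm-completions -/

section Uniqueness

open MV

theorem IsRieszMVHom.map_odot {A B : Type*} [RieszMVOps A] [RieszMVOps B] {f : A → B}
    (hf : IsRieszMVHom f) (x y : A) : f (odot x y) = odot (f x) (f y) := by
  rw [odot, hf.map_neg, hf.map_oplus, hf.map_neg, hf.map_neg, ← odot]

theorem IsRieszMVHom.rho_map {A B : Type*} [RieszMVOps A] [RieszMVOps B] {f : A → B}
    (hf : IsRieszMVHom f) {s : A → ℝ} {t : B → ℝ} (h : ∀ a, t (f a) = s a) (x y : A) :
    rho t (f x) (f y) = rho s x y := by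
  rw [rho, rho, ← h, hf.map_oplus, hf.map_odot, hf.map_odot, hf.map_neg, hf.map_neg]

/-! ### Continuity of the operations for the metric of a state. -/

section Continuity

variable {A : Type*} [RieszMVOps A] [hA : Fact (IsRieszMVAlgebra A)] [MetricSpace A] {t : A → ℝ}

theorem continuous_neg_of_rho (hd : ∀ x y : A, dist x y = rho t x y) :
    Continuous (neg : A → A) :=
  (Isometry.of_dist_eq fun x y => by rw [hd, hd, rho_neg]).continuous

theorem continuous_scal_of_rho (ht : IsState t) (hd : ∀ x y : A, dist x y = rho t x y) (r : I) :
    Continuous (scal r : A → A) :=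
  (LipschitzWith.of_dist_le_mul (K := 1) fun x y => by
    rw [hd, hd, NNReal.coe_one, one_mul]; exact rho_scal_le ht r x y).continuous

theorem continuous_oplus_of_rho (ht : IsState t) (hd : ∀ x y : A, dist x y = rho t x y) :
    Continuous (fun p : A × A => oplus p.1 p.2) := by
  have h (x y z : A) : dist (oplus x y) (oplus x z) ≤ dist y z := by
    rw [hd, hd]; exact rho_oplus_le ht x y z
  -- The sum is 1-Lipschitz in each variable, and the product carries the maximum metric, whence the
  -- constant `2`.
  refine (LipschitzWith.of_dist_le_mul (K := 2) fun p q => ?_).continuous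
  have h1 := dist_triangle (oplus p.1 p.2) (oplus p.1 q.2) (oplus q.1 q.2)
  have h2 := h p.1 p.2 q.2
  have h3 := h q.2 p.1 q.1
  rw [oplus_comm q.2, oplus_comm q.2] at h3
  have h4 : dist p.1 q.1 ≤ dist p q := le_max_left _ _
  have h5 : dist p.2 q.2 ≤ dist p q := le_max_right _ _
  rw [NNReal.coe_ofNat]
  linarith

theorem continuous_state_of_rho (hd : ∀ x y : A, dist x y = rho t x y) : Continuous t := by
  have : t = fun x => dist x zero := funext fun x => by rw [hd, rho_zero]
  rw [this]
  fun_prop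

end Continuity

/-- Two norm-completions of the same algebra are isomorphic. -/
theorem IsNormCompletion.exists_equiv {A B C : Type*} [RieszMVOps A] [RieszMVOps B] [RieszMVOps C]
    {s : A → ℝ} {t : B → ℝ} {u : C → ℝ} {ι : A → B} {j : A → C}
    (hι : IsNormCompletion s t ι) (hj : IsNormCompletion s u j) :
    ∃ e : B ≃ C, IsRieszMVHom e ∧ (∀ b, u (e b) = t b) ∧ ∀ a, e (ι a) = j a := by
  have : Fact (IsRieszMVAlgebra B) := ⟨hι.target.isRieszMVAlgebra⟩
  have : Fact (IsRieszMVAlgebra C) := ⟨hj.target.isRieszMVAlgebra⟩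
  obtain ⟨mB, dB, cB⟩ := hι.complete
  obtain ⟨mC, dC, cC⟩ := hj.complete
  -- `A` carries the metric pulled back along `ι`. As `ι` and `j` both preserve `ρ`, `j` is an
  -- isometry for it too, so `B` and `C` complete the same space. The canonical equivalence then
  -- satisfies every required identity on the dense range of `ι`, and both sides are continuous.
  let _ : PseudoMetricSpace A := PseudoMetricSpace.induced ι mB.toPseudoMetricSpace
  have hι_dense : DenseRange ι := Metric.denseRange_iff.2 fun b r hr => by
    obtain ⟨a, ha⟩ := hι.dense b r hr
    exact ⟨a, by rwa [dist_comm, dB]⟩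
  have hj_dense : DenseRange j := Metric.denseRange_iff.2 fun b r hr => by
    obtain ⟨a, ha⟩ := hj.dense b r hr
    exact ⟨a, by rwa [dist_comm, dC]⟩
  have hι_isom : Isometry ι := Isometry.of_dist_eq fun _ _ => rfl
  have hj_isom : Isometry j := Isometry.of_dist_eq fun x y => by
    rw [← hι_isom.dist_eq, dB, dC, hι.hom.rho_map hι.norm_map, hj.hom.rho_map hj.norm_map]
  let pB : AbstractCompletion A :=
    { space := B, coe := ι, uniformStruct := inferInstance, complete := cB,
      separation := inferInstance, isUniformInducing := hι_isom.isUniformInducing,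
      dense := hι_dense }
  let pC : AbstractCompletion A :=
    { space := C, coe := j, uniformStruct := inferInstance, complete := cC,
      separation := inferInstance, isUniformInducing := hj_isom.isUniformInducing,
      dense := hj_dense }
  let e : B ≃ᵤ C := pB.compareEquiv pC
  have he : ∀ a, e (ι a) = j a := pB.compare_coe pC
  have hc : Continuous e := e.continuous
  refine ⟨e.toEquiv, ⟨fun x y => ?_, fun x => ?_, ?_, fun r x => ?_⟩, fun b => ?_, he⟩
  · change e (oplus x y) = oplus (e x) (e y)
    refine hι_dense.induction_on₂ ?_ (fun a b => ?_) x y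
    · exact isClosed_eq (hc.comp (continuous_oplus_of_rho hι.target.isState dB))
        ((continuous_oplus_of_rho hj.target.isState dC).comp
          ((hc.comp continuous_fst).prodMk (hc.comp continuous_snd)))
    · rw [← hι.hom.map_oplus, he, he, he, hj.hom.map_oplus]
  · change e (neg x) = neg (e x)
    refine hι_dense.induction_on x ?_ (fun a => ?_)
    · exact isClosed_eq (hc.comp (continuous_neg_of_rho dB)) ((continuous_neg_of_rho dC).comp hc)
    · rw [← hι.hom.map_neg, he, he, hj.hom.map_neg]
  · change e zero = zero
    rw [← hι.hom.map_zero, he, hj.hom.map_zero]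
  · change e (scal r x) = scal r (e x)
    refine hι_dense.induction_on x ?_ (fun a => ?_)
    · exact isClosed_eq (hc.comp (continuous_scal_of_rho hι.target.isState dB r))
        ((continuous_scal_of_rho hj.target.isState dC r).comp hc)
    · rw [← hι.hom.map_scal, he, he, hj.hom.map_scal]
  · change u (e b) = t b
    refine hι_dense.induction_on b ?_ (fun a => ?_)
    · exact isClosed_eq ((continuous_state_of_rho dC).comp hc) (continuous_state_of_rho dB)
    · rw [he, hι.norm_map, hj.norm_map]

end Uniqueness

/-! ### Term functions -/

namespace Formula

open MV

section Terms

variable {V : Type*}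

theorem continuous_eval (φ : Formula V) : Continuous fun x : V → I => φ.eval x := by
  refine continuous_induced_rng.2 ?_
  induction φ with
  | var i => exact continuous_subtype_val.comp (continuous_apply i)
  | not φ ih => exact continuous_const.sub ih
  | imp φ ψ ih1 ih2 => exact continuous_const.min ((continuous_const.sub ih1).add ih2)
  | nabla r φ ih => exact continuous_const.sub (continuous_const.mul (continuous_const.sub ih))

/-- The term function of a formula as a real-valued continuous function. -/
noncomputable def toContinuousMap (φ : Formula V) : C(V → I, ℝ) :=
  ⟨fun x => φ.eval x, continuous_subtype_val.comp φ.continuous_eval⟩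

variable (x : V → I)

theorem coe_eval_not (φ : Formula V) : ((not φ).eval x : ℝ) = 1 - φ.eval x := rfl

theorem coe_eval_imp (φ ψ : Formula V) :
    ((imp φ ψ).eval x : ℝ) = min 1 (1 - (φ.eval x : ℝ) + ψ.eval x) := rfl

theorem coe_eval_delta (r : I) (φ : Formula V) : ((delta r φ).eval x : ℝ) = r * φ.eval x := by
  change 1 - (1 - (r : ℝ) * (1 - (1 - (φ.eval x : ℝ)))) = _
  ring

/-- `φ ⊕ ψ`. -/
def add (φ ψ : Formula V) : Formula V := imp (not φ) ψ

theorem coe_eval_add (φ ψ : Formula V) :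
    ((add φ ψ).eval x : ℝ) = min 1 ((φ.eval x : ℝ) + ψ.eval x) := by
  rw [add, coe_eval_imp, coe_eval_not, sub_sub_cancel]

/-- `φ ∨ ψ`. -/
def sup (φ ψ : Formula V) : Formula V := imp (imp φ ψ) ψ

theorem coe_eval_sup (φ ψ : Formula V) :
    ((sup φ ψ).eval x : ℝ) = max (φ.eval x : ℝ) (ψ.eval x) := by
  rw [sup, coe_eval_imp, coe_eval_imp]
  have := (φ.eval x).2.2; have := (ψ.eval x).2.2
  grind

/-- `r φ ⊕ (1 - r) ψ`. -/
def mix (r : I) (φ ψ : Formula V) : Formula V := add (delta r φ) (delta (σ r) ψ)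

theorem coe_eval_mix (r : I) (φ ψ : Formula V) :
    ((mix r φ ψ).eval x : ℝ) = r * φ.eval x + (1 - r) * ψ.eval x := by
  rw [mix, coe_eval_add, coe_eval_delta, coe_eval_delta, coe_symm_eq, min_eq_right]
  have h1 := mul_le_of_le_one_right r.2.1 (φ.eval x).2.2
  have h2 := mul_le_of_le_one_right (sub_nonneg.2 r.2.2) (ψ.eval x).2.2
  linarith

/-- The formula `r (v → v)`, whose value is `r`. -/
def const [Inhabited V] (r : I) : Formula V := delta r (imp (var default) (var default))

theorem coe_eval_const [Inhabited V] (r : I) : ((const r).eval x : ℝ) = r := by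
  rw [const, coe_eval_delta, coe_eval_imp, sub_add_cancel, min_self, mul_one]

/-- The sum `φ ⊕ ⋯ ⊕ φ` with `k` summands. -/
def multiple [Inhabited V] (φ : Formula V) : ℕ → Formula V
  | 0 => const 0
  | k + 1 => add (multiple φ k) φ

theorem coe_eval_multiple [Inhabited V] (φ : Formula V) (k : ℕ) :
    ((multiple φ k).eval x : ℝ) = min 1 ((k : ℝ) * φ.eval x) := by
  have := (φ.eval x).2.1
  induction k with
  | zero => rw [multiple, coe_eval_const]; simp
  | succ k ih =>
    rw [multiple, coe_eval_add, ih, Nat.cast_succ, add_mul, one_mul]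
    grind

end Terms

variable {V : Type*}

/-- `g` is piecewise linear if some `l g + 1/2` with `l > 0` is a term function. -/
def IsPiecewiseLinear (g : C(V → I, ℝ)) : Prop :=
  ∃ l : ℝ, 0 < l ∧ ∃ φ : Formula V, ∀ x, (φ.eval x : ℝ) = l * g x + 1 / 2

namespace IsPiecewiseLinear

variable {g h : C(V → I, ℝ)}

theorem neg (hg : IsPiecewiseLinear g) : IsPiecewiseLinear (-g) := by
  obtain ⟨l, hl, φ, hφ⟩ := hg
  refine ⟨l, hl, .not φ, fun x => ?_⟩
  rw [coe_eval_not, hφ, ContinuousMap.neg_apply]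
  ring

variable [Inhabited V]

/-- The scalar `1/2`. -/
noncomputable def half : I := ⟨1 / 2, by norm_num, by norm_num⟩

theorem coe_half : (half : ℝ) = 1 / 2 := rfl

/-- Mixing with the constant `1/2` shrinks the slope while keeping the offset: `(m/l)(l g + 1/2) +
(1 - m/l)/2 = m g + 1/2`. Any two piecewise linear functions can thus be given the same factor. -/
theorem exists_scale (hg : IsPiecewiseLinear g) : ∃ l : ℝ, 0 < l ∧ ∀ m, 0 < m → m ≤ l →
    ∃ φ : Formula V, ∀ x, (φ.eval x : ℝ) = m * g x + 1 / 2 := by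
  obtain ⟨l, hl, φ, h⟩ := hg
  refine ⟨l, hl, fun m hm hml => ?_⟩
  refine ⟨mix ⟨m / l, by positivity, (div_le_one hl).2 hml⟩ φ (const half), fun x => ?_⟩
  rw [coe_eval_mix, coe_eval_const, h, coe_half]
  field_simp
  ring

theorem exists_common (hg : IsPiecewiseLinear g) (hh : IsPiecewiseLinear h) :
    ∃ l : ℝ, 0 < l ∧ ∃ φ ψ : Formula V, (∀ x, (φ.eval x : ℝ) = l * g x + 1 / 2) ∧
      ∀ x, (ψ.eval x : ℝ) = l * h x + 1 / 2 := by
  obtain ⟨l, hl, h1⟩ := hg.exists_scale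
  obtain ⟨m, hm, h2⟩ := hh.exists_scale
  obtain ⟨φ, hφ⟩ := h1 (min l m) (lt_min hl hm) (min_le_left _ _)
  obtain ⟨ψ, hψ⟩ := h2 (min l m) (lt_min hl hm) (min_le_right _ _)
  exact ⟨_, lt_min hl hm, φ, ψ, hφ, hψ⟩

theorem add (hg : IsPiecewiseLinear g) (hh : IsPiecewiseLinear h) :
    IsPiecewiseLinear (g + h) := by
  obtain ⟨l, hl, φ, ψ, hφ, hψ⟩ := hg.exists_common hh
  refine ⟨l / 2, by positivity, mix half φ ψ, fun x => ?_⟩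
  rw [coe_eval_mix, hφ, hψ, coe_half, ContinuousMap.add_apply]
  ring

theorem sup (hg : IsPiecewiseLinear g) (hh : IsPiecewiseLinear h) :
    IsPiecewiseLinear (g ⊔ h) := by
  obtain ⟨l, hl, φ, ψ, hφ, hψ⟩ := hg.exists_common hh
  refine ⟨l, hl, .sup φ ψ, fun x => ?_⟩
  rw [coe_eval_sup, hφ, hψ, ContinuousMap.sup_apply, mul_max_of_nonneg _ _ hl.le,
    max_add_add_right]

theorem inf (hg : IsPiecewiseLinear g) (hh : IsPiecewiseLinear h) :
    IsPiecewiseLinear (g ⊓ h) := by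
  have := (hg.neg.sup hh.neg).neg
  rwa [neg_sup, _root_.neg_neg, _root_.neg_neg] at this

theorem of_eval (φ : Formula V) : IsPiecewiseLinear φ.toContinuousMap := by
  refine ⟨1 / 2, by norm_num, mix half φ (const 1), fun x => ?_⟩
  rw [coe_eval_mix, coe_eval_const, coe_half]
  change _ = 1 / 2 * (φ.eval x : ℝ) + 1 / 2
  norm_num

theorem smul (hg : IsPiecewiseLinear g) (r : ℝ) : IsPiecewiseLinear (r • g) := by
  have hpos : ∀ r : ℝ, 0 < r → IsPiecewiseLinear (r • g) := by
    intro r hr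
    obtain ⟨l, hl, φ, hφ⟩ := hg
    refine ⟨l / r, by positivity, φ, fun x => ?_⟩
    rw [hφ, ContinuousMap.smul_apply, smul_eq_mul]
    field_simp
  rcases lt_trichotomy r 0 with h | rfl | h
  · have := (hpos (-r) (neg_pos.2 h)).neg
    rwa [neg_smul, _root_.neg_neg] at this
  · refine ⟨1, one_pos, const half, fun x => ?_⟩
    rw [coe_eval_const, coe_half]
    simp
  · exact hpos r h

/-- Lattice form of Stone-Weierstrass: a sublattice of `C(V → I, ℝ)` that takes prescribed values at
any two points is dense. -/
theorem closure_eq_univ : closure {g : C(V → I, ℝ) | IsPiecewiseLinear g} = ⊤ := by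
  refine ContinuousMap.sublattice_closure_eq_top _ ⟨_, of_eval (const 0)⟩
    (fun _ hf _ hg => hf.inf hg) (fun _ hf _ hg => hf.sup hg) ?_
  intro v x y
  by_cases hxy : x = y
  · subst hxy
    refine ⟨_, (of_eval (const 1)).smul (v x), ?_, ?_⟩ <;>
    · change v x * ((const (1 : I) : Formula V).eval x : ℝ) = v x
      rw [coe_eval_const, Set.Icc.coe_one, mul_one]
  · obtain ⟨i, hi⟩ := Function.ne_iff.1 hxy
    have hi' : (x i : ℝ) - y i ≠ 0 := sub_ne_zero.2 fun h => hi (Subtype.ext h)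
    -- Slope of the affine function of the separating coordinate `i` that takes the values `v x` and
    -- `v y`.
    set r := (v x - v y) / ((x i : ℝ) - y i) with hr
    refine ⟨_, ((of_eval (var i)).smul r).add ((of_eval (const 1)).smul (v x - r * x i)), ?_, ?_⟩
    · change r * (x i : ℝ) + (v x - r * x i) * ((const (1 : I) : Formula V).eval x : ℝ) = v x
      rw [coe_eval_const, Set.Icc.coe_one]
      ring
    · change r * (y i : ℝ) + (v x - r * x i) * ((const (1 : I) : Formula V).eval y : ℝ) = v y
      rw [coe_eval_const, Set.Icc.coe_one]
      have : r * ((x i : ℝ) - y i) = v x - v y := div_mul_cancel₀ _ hi'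
      linarith

/-- The truncation of a piecewise linear function to `[0,1]` is a term function. -/
theorem exists_eval_eq_clip (hg : IsPiecewiseLinear g) :
    ∃ φ : Formula V, ∀ x, φ.eval x = clip (g x) := by
  obtain ⟨l, hl, h⟩ := hg.exists_scale
  obtain ⟨k, hk⟩ := exists_nat_gt (1 / l)
  have hk0 : (0 : ℝ) < k := lt_trans (by positivity) hk
  obtain ⟨φ, hφ⟩ := h (1 / k) (by positivity) (by
    rw [div_le_iff₀ hk0]; rw [div_lt_iff₀ hl] at hk; linarith)
  -- With `φ = g/k + 1/2`, the formula `¬(φ → 1/2)` has value `max 0 (g/k)`, and its `k`-fold sum is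
  -- `min 1 (max 0 g)`. The choice `k > 1/l` makes the factor `1/k` admissible.
  refine ⟨multiple (.not (.imp φ (const half))) k, fun x => Subtype.ext ?_⟩
  rw [coe_eval_multiple, coe_eval_not, coe_eval_imp, coe_eval_const, coe_half, hφ, clip,
    Set.coe_projIcc]
  have : (1 : ℝ) - min 1 (1 - (1 / k * g x + 1 / 2) + 1 / 2) = max 0 (1 / k * g x) := by grind
  rw [this, mul_max_of_nonneg _ _ hk0.le, mul_zero, ← mul_assoc, mul_one_div_cancel hk0.ne',
    one_mul]
  grind

end IsPiecewiseLinear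

end Formula

/-! ### The embedding of the Lindenbaum-Tarski algebra -/

namespace RL

open Formula

variable {n : ℕ}

/-- The term function of an element of `RL n`. -/
noncomputable def eval (a : RL n) (x : Fin n → I) : I :=
  Quotient.lift (fun φ : Formula (Fin n) => φ.eval x)
    (fun φ ψ (h : Provable (.imp φ ψ) ∧ Provable (.imp ψ φ)) => Provable.eval_eq h.1 h.2 x) a

theorem continuous_eval (a : RL n) : Continuous (eval a) := by
  induction a using ind with | _ φ
  exact φ.continuous_eval

theorem integral_eq (a : RL n) : integral n a = ∫ x, (eval a x : ℝ) := by
  induction a using ind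
  rfl

theorem integrable_eval (a : RL n) : Integrable fun x => (eval a x : ℝ) :=
  integrable_coe (continuous_subtype_val.comp a.continuous_eval).aestronglyMeasurable

/-- The class of the term function of an element of `RL n`. -/
noncomputable def toL1u (a : RL n) : L1u n :=
  ⟨(integrable_eval a).toL1 _, by
    filter_upwards [(integrable_eval a).coeFn_toL1] with x h
    rw [h]
    exact (eval a x).2⟩

theorem coeFn_toL1u (a : RL n) : (toL1u a).1 =ᵐ[volume] fun x => (eval a x : ℝ) :=
  (integrable_eval a).coeFn_toL1

theorem rep_toL1u (a : RL n) : L1u.rep (toL1u a) =ᵐ[volume] eval a :=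
  L1u.rep_ae_eq (coeFn_toL1u a)

theorem integral_toL1u (a : RL n) : L1u.integral n (toL1u a) = integral n a := by
  rw [integral_eq]
  exact integral_congr_ae (coeFn_toL1u a)

variable [NeZero n]

theorem eval_injective : Function.Injective (eval : RL n → (Fin n → I) → I) := by
  intro a b h
  induction a using ind
  induction b using ind
  exact mk_eq_mk_iff_eval.2 (congrFun h)

theorem eval_oplus (a b : RL n) (x : Fin n → I) :
    eval (oplus a b) x = oplus (eval a x) (eval b x) := by
  induction a using ind; induction b using ind
  exact Subtype.ext (coe_eval_add x _ _)

theorem eval_neg (a : RL n) (x : Fin n → I) : eval (neg a) x = neg (eval a x) := by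
  induction a using ind
  rfl

theorem eval_zero (x : Fin n → I) : eval (zero : RL n) x = zero := by
  apply Subtype.ext
  change ((Formula.not (.imp (.var 0) (.var 0))).eval x : ℝ) = 0
  rw [coe_eval_not, coe_eval_imp, sub_add_cancel, min_self, sub_self]

theorem eval_scal (r : I) (a : RL n) (x : Fin n → I) :
    eval (scal r a) x = scal r (eval a x) := by
  induction a using ind
  exact Subtype.ext (coe_eval_delta x _ _)

theorem isRieszMVHom_toL1u : IsRieszMVHom (toL1u : RL n → L1u n) where
  map_oplus a b := by
    apply L1u.ext_rep
    filter_upwards [rep_toL1u (oplus a b), rep_toL1u a, rep_toL1u b,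
      L1u.rep_oplus (toL1u a) (toL1u b)] with x h1 h2 h3 h4
    rw [h1, h4, h2, h3, eval_oplus]
  map_neg a := by
    apply L1u.ext_rep
    filter_upwards [rep_toL1u (neg a), rep_toL1u a, L1u.rep_neg (toL1u a)] with x h1 h2 h3
    rw [h1, h3, h2, eval_neg]
  map_zero := by
    apply L1u.ext_rep
    filter_upwards [rep_toL1u (zero : RL n), L1u.rep_zero (n := n)] with x h1 h2
    rw [h1, h2, eval_zero]
  map_scal r a := by
    apply L1u.ext_rep
    filter_upwards [rep_toL1u (scal r a), rep_toL1u a, L1u.rep_scal r (toL1u a)] with x h1 h2 h3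
    rw [h1, h3, h2, eval_scal]

/-- Term functions are continuous, so equality almost everywhere is equality everywhere;
`eval_injective`, which is completeness of the logic, does the rest. -/
theorem toL1u_injective : Function.Injective (toL1u : RL n → L1u n) := by
  intro a b h
  apply eval_injective
  refine ((continuous_eval a).ae_eq_iff_eq volume (continuous_eval b)).1 ?_
  have := rep_toL1u b
  rw [← h] at this
  exact (rep_toL1u a).symm.trans this

theorem isNormed_integral : IsNormed (integral n) where
  isRieszMVAlgebra := isRieszMVAlgebra
  isState :=
    { mem_Icc := fun a => integral_toL1u a ▸ L1u.isState_integral.mem_Icc _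
      map_one := by
        rw [← integral_toL1u, isRieszMVHom_toL1u.map_one, L1u.isState_integral.map_one]
      map_oplus := fun a b h => by
        have hom := isRieszMVHom_toL1u (n := n)
        rw [← integral_toL1u, ← integral_toL1u, ← integral_toL1u, hom.map_oplus]
        refine L1u.isState_integral.map_oplus _ _ ?_
        rw [← hom.map_odot, h, hom.map_zero] }
  faithful a h := by
    apply toL1u_injective
    rw [isRieszMVHom_toL1u.map_zero]
    exact L1u.isNormed_integral.faithful _ (integral_toL1u a ▸ h)

theorem exists_rho_toL1u_lt (f : L1u n) {ε : ℝ} (hε : 0 < ε) :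
    ∃ a : RL n, rho (L1u.integral n) (toL1u a) f < ε := by
  have : Inhabited (Fin n) := ⟨0⟩
  -- Piecewise linear functions are dense in `C([0,1]^n)`, whose image is dense in `L^1`.
  have hd : Dense (ContinuousMap.toLp 1 (volume : Measure (Fin n → I)) ℝ ''
      {g : C(Fin n → I, ℝ) | IsPiecewiseLinear g}) :=
    (ContinuousMap.toLp_denseRange ℝ volume ℝ ENNReal.one_ne_top).dense_image
      (ContinuousLinearMap.continuous _)
      (dense_iff_closure_eq.2 IsPiecewiseLinear.closure_eq_univ)
  obtain ⟨_, ⟨g, hg, rfl⟩, hlt⟩ := hd.exists_dist_lt f.1 hε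
  obtain ⟨φ, hφ⟩ := IsPiecewiseLinear.exists_eval_eq_clip hg
  refine ⟨mk φ, lt_of_le_of_lt ?_ hlt⟩
  rw [← L1u.dist_eq_rho, dist_comm, dist_eq_norm, dist_eq_norm, L1.norm_eq_integral_norm,
    L1.norm_eq_integral_norm]
  -- As `f` has values in `[0,1]`, replacing `g` by its truncation only decreases the pointwise
  -- distance to `f`.
  refine integral_mono_ae (L1.integrable_coeFn _).norm (L1.integrable_coeFn _).norm ?_
  filter_upwards [f.2, coeFn_toL1u (mk φ), Lp.coeFn_sub f.1 (toL1u (mk φ)).1,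
    Lp.coeFn_sub f.1 (ContinuousMap.toLp 1 volume ℝ g),
    ContinuousMap.coeFn_toLp (p := 1) (𝕜 := ℝ) volume g] with x h1 h2 h3 h4 h5
  have h6 : eval (mk φ) x = MV.clip (g x) := hφ x
  rw [h3, h4, Pi.sub_apply, Pi.sub_apply, h2, h5, h6, MV.clip, Set.coe_projIcc,
    Real.norm_eq_abs, Real.norm_eq_abs]
  simp only [Set.mem_Icc] at h1
  grind

theorem isNormCompletion_toL1u :
    IsNormCompletion (integral n) (L1u.integral n) (toL1u : RL n → L1u n) where
  source := isNormed_integral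
  target := L1u.isNormed_integral
  complete := L1u.isStateComplete_integral
  hom := isRieszMVHom_toL1u
  injective := toL1u_injective
  norm_map := integral_toL1u
  dense f _ hε := exists_rho_toL1u_lt f hε

end RL

end RMV

theorem mainTheorem5 (n : ℕ) [NeZero n] :
    RMV.IsRieszMVAlgebra (RMV.L1u n) ∧
    RMV.IsNormed (RMV.L1u.integral n) ∧
    RMV.IsStateComplete (RMV.L1u.integral n) ∧
    ∃ ι : RMV.RL n → RMV.L1u n,
      (∀ φ : RMV.Formula (Fin n),
        (ι (RMV.RL.mk φ)).1 =ᵐ[volume] fun x => (φ.eval x : ℝ)) ∧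
      RMV.IsNormCompletion (RMV.RL.integral n) (RMV.L1u.integral n) ι ∧
      ∀ (B : Type*) [RMV.RieszMVOps B] (t : B → ℝ) (j : RMV.RL n → B),
        RMV.IsNormCompletion (RMV.RL.integral n) t j →
          ∃ e : RMV.L1u n ≃ B, RMV.IsRieszMVHom e ∧
            (∀ f, t (e f) = RMV.L1u.integral n f) ∧ ∀ a, e (ι a) = j a :=
  ⟨RMV.L1u.isRieszMVAlgebra, RMV.L1u.isNormed_integral, RMV.L1u.isStateComplete_integral,
    RMV.RL.toL1u, fun φ => RMV.RL.coeFn_toL1u (RMV.RL.mk φ), RMV.RL.isNormCompletion_toL1u,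
    fun _ _ _ _ h => RMV.RL.isNormCompletion_toL1u.exists_equiv h⟩
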